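/- Call a real number $r$ computable if it is the limit of some computable sequence of rational numbers (no computable rate of convergence is required). For a set $\mathcal S$ of prime numbers, let $\mathbb Z[\mathcal S^{-1}]\subseteq\mathbb Q$ be the subring generated by the inverses of the elements of $\mathcal S$, and let the lower density of $\mathcal S$ be $$\liminf_{N\to\infty}\frac{\#\{p\in\mathcal S : p\le N\}}{\#\{p \text{ prime} : p\le N\}}.$$ Fix a computable enumeration $f_0,f_1,f_2,\dots$ of all polynomials, in any number of variables, with integer coefficients. For a commutative ring $R$ let $\operatorname{HTP}(R)$ be the set of all indices $e$ such that $f_e$ has a zero with coordinates in $R$, and let $\equiv_T$ denote Turing equivalence of sets of natural numbers. Theorem. For every computable real number $r$ with $0\le r\le 1$ there exists a computably enumerable set $\mathcal S$ of prime numbers such that the lower density of $\mathcal S$ is $r$ and $\operatorname{HTP}(\mathbb Z[\mathcal S^{-1}])\equiv_T\operatorname{HTP}(\mathbb Q)$. -/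

import Mathlib

open Filter Topology

/-- A real number `r` is a *computable real* (in the number-theoretic sense) if it is the limit of
some computable sequence of rational numbers `a n / b n`; no rate of convergence is required. -/
def IsComputableReal (r : ℝ) : Prop :=
  ∃ (a : ℕ → ℤ) (b : ℕ → ℕ), Computable a ∧ Computable b ∧ (∀ n, 0 < b n) ∧
    Tendsto (fun n => (a n : ℝ) / (b n : ℝ)) atTop (𝓝 r)

/-- The lower density of a set `S` of primes: the lower limit, as `N → ∞`, of
`#{p ∈ S : p ≤ N} / #{p prime : p ≤ N}`. The quotients lie in `[0, 1]`. -/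
noncomputable def lowerPrimeDensity (S : Set ℕ) : ℝ :=
  liminf (fun N : ℕ => ({p : ℕ | p.Prime ∧ p ∈ S ∧ p ≤ N}.ncard : ℝ) /
    ({p : ℕ | p.Prime ∧ p ≤ N}.ncard : ℝ)) atTop

/-- The subring `ℤ[S⁻¹]` of `ℚ`, generated by the inverses of the elements of `S`. -/
def invertedRing (S : Set ℕ) : Subring ℚ :=
  Subring.closure {q : ℚ | ∃ p ∈ S, q = (p : ℚ)⁻¹}

/-- The polynomial in `ℤ[X₀, X₁, …]` given by a finite list of terms: the pair
`(c, [i₁, …, iₖ])` stands for the term `c * X_{i₁} * ⋯ * X_{iₖ}`. -/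
noncomputable def polyOfTerms (L : List (ℤ × List ℕ)) : MvPolynomial ℕ ℤ :=
  (L.map fun t => MvPolynomial.C t.1 * (t.2.map MvPolynomial.X).prod).sum

/-- A computable enumeration `f₀, f₁, …` of all polynomials in any number of variables with
integer coefficients: the index `e` is decoded to a finite list of terms. -/
noncomputable def polyOfIndex (e : ℕ) : MvPolynomial ℕ ℤ :=
  polyOfTerms (Denumerable.ofNat (List (ℤ × List ℕ)) e)

/-- Every polynomial with integer coefficients occurs in the enumeration. -/
theorem polyOfIndex_surjective : Function.Surjective polyOfIndex := by
  have key : ∀ f : MvPolynomial ℕ ℤ, ∃ L, polyOfTerms L = f := by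
    intro f
    induction f using MvPolynomial.induction_on with
    | C a => exact ⟨[(a, [])], by simp [polyOfTerms]⟩
    | add p q hp hq =>
      obtain ⟨L, rfl⟩ := hp
      obtain ⟨M, rfl⟩ := hq
      exact ⟨L ++ M, by simp [polyOfTerms]⟩
    | mul_X p n hp =>
      obtain ⟨L, rfl⟩ := hp
      refine ⟨L.map fun t => (t.1, n :: t.2), ?_⟩
      simp only [polyOfTerms, List.map_map, ← List.sum_map_mul_right]
      congr 1
      apply List.map_congr_left
      intro t _
      simp only [Function.comp, List.map_cons, List.prod_cons]
      ring
  intro f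
  obtain ⟨L, hL⟩ := key f
  exact ⟨Encodable.encode L, by simp [polyOfIndex, hL]⟩

/-- Hilbert's Tenth Problem over `R`, as a set of natural numbers: the indices of the integer
polynomials that have a zero in `R`. A polynomial involves only finitely many of the variables,
so the values of an assignment `x : ℕ → R` at the other variables are irrelevant. -/
def HTP (R : Type*) [CommRing R] : Set ℕ :=
  {e | ∃ x : ℕ → R, MvPolynomial.aeval x (polyOfIndex e) = 0}

open Classical in
/-- The characteristic function of a set of natural numbers. -/
noncomputable def charFun (A : Set ℕ) : ℕ →. ℕ :=
  fun n => Part.some (if n ∈ A then 1 else 0)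

/-- Turing equivalence of two sets of natural numbers. -/
def SetTuringEquivalent (A B : Set ℕ) : Prop :=
  TuringEquivalent (charFun A) (charFun B)

/-! The set `S` arises from a computable set `B` of primes of density `r` by a priority
construction. `B` is `greedySet`: an odd prime enters exactly when the proportion chosen so far lies
below the current approximation `a n / b n`. No rate of convergence is needed, since a choice made
before the approximations are close to `r` costs only a bounded error.

Requirement `e` tries to give the `e`-th polynomial a zero in ℤ[S⁻¹]. It may use denominators built
from primes of `B`, primes dividing the product `D` of the denominators used so far, and primes
above its restraint, which is raised when a requirement of smaller index acts. Each requirement acts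
at most once. At the first stage from which no requirement below `k` acts, the restraint of `k` is
`2 ^ ((k + 1) * D)`. Up to that bound `S` exceeds `B` only by divisors of `D`, hence by at most `D`
primes, while Bertrand's postulate supplies at least `(k + 1) * D` primes. So the excess has share
at most `1 / (k + 1)` for arbitrarily large `N`, and the lower density is still `r`
(`frequently_count_injurySet_le`, `lowerPrimeDensity_eq`).

At any stage only finitely many primes are forbidden to a requirement, all odd because `2 ∈ B`.
Whether it could still act is therefore a question about a semilocal subring of ℚ. This question
reduces to ℚ by a Diophantine condition, `QuadIntegral p q`, satisfied by all integers and only by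
`p`-integral rationals, where `q` is an auxiliary prime that is a non-residue modulo `p`. An oracle
for HTP(ℚ) thus recognises a stage at which all requirements up to `e` are settled
(`unsettledQuery_mem_iff`). From then on the answer for `e` is whether it has acted. Conversely,
HTP(ℚ) reduces to HTP of every subring of ℚ by clearing denominators and expressing `w ≠ 0` through
sums of four squares (`HTP_rat_turingReducible`). -/

/-! ### Conics over ℚ and quadratic reciprocity -/

theorem not_isSquare_prime_mul {p m : ℕ} (hp : p.Prime) (hm : ¬ p ∣ m) : ¬ IsSquare (p * m) := by
  rintro ⟨k, hk⟩
  have h1 : p ∣ k * k := ⟨m, hk.symm⟩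
  have h2 : p ∣ k := by rcases (hp.dvd_mul).1 h1 with h | h <;> exact h
  obtain ⟨j, rfl⟩ := h2
  apply hm
  refine ⟨j * j, ?_⟩
  apply Nat.eq_of_mul_eq_mul_left hp.pos
  rw [hk]; ring

/-- A pigeonhole form of Legendre's theorem on the conic `a x² + b y² = c z²`. -/
theorem exists_point_on_conic {a b c : ℕ} (ha : 0 < a) (hb : 0 < b) (hc : 0 < c)
    (hab : a.Coprime b) (hac : a.Coprime c) (hbc : b.Coprime c) (hsq : ¬ IsSquare (a * b))
    {e₁ e₂ e₃ : ℤ} (h₁ : (a : ℤ) ∣ b * e₁ ^ 2 - c) (h₂ : (b : ℤ) ∣ a * e₂ ^ 2 - c)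
    (h₃ : (c : ℤ) ∣ a * e₃ ^ 2 + b) :
    ∃ x y z : ℤ, ¬ (x = 0 ∧ y = 0 ∧ z = 0) ∧ (a : ℤ) * x ^ 2 + b * y ^ 2 = c * z ^ 2 := by
  have : NeZero a := ⟨ha.ne'⟩
  have : NeZero b := ⟨hb.ne'⟩
  have : NeZero c := ⟨hc.ne'⟩
  set X := Nat.sqrt (b * c) with hXdef
  set Y := Nat.sqrt (a * c) with hYdef
  set Z := Nat.sqrt (a * b) with hZdef
  have hX : b * c < (X + 1) ^ 2 := Nat.lt_succ_sqrt' _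
  have hY : a * c < (Y + 1) ^ 2 := Nat.lt_succ_sqrt' _
  have hZ : a * b < (Z + 1) ^ 2 := Nat.lt_succ_sqrt' _
  have hX' : X ^ 2 ≤ b * c := Nat.sqrt_le' _
  have hY' : Y ^ 2 ≤ a * c := Nat.sqrt_le' _
  have hZ' : Z ^ 2 < a * b := by
    refine lt_of_le_of_ne (Nat.sqrt_le' _) fun h => hsq ⟨Z, ?_⟩
    rw [← h, sq]
  let s : Finset (ℕ × ℕ × ℕ) :=
    Finset.range (X + 1) ×ˢ Finset.range (Y + 1) ×ˢ Finset.range (Z + 1)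
  -- Linear congruences whose solutions make the quadratic form vanish modulo `a`, `b` and `c`. The
  -- box has more than `abc` points, so two of them share a value.
  let F : ℕ × ℕ × ℕ → ZMod a × ZMod b × ZMod c := fun v =>
    ((v.2.1 : ZMod a) - (e₁ : ZMod a) * v.2.2, (v.1 : ZMod b) - (e₂ : ZMod b) * v.2.2,
      (v.1 : ZMod c) - (e₃ : ZMod c) * v.2.1)
  have hcard : (Finset.univ : Finset (ZMod a × ZMod b × ZMod c)).card < s.card := by
    simp only [s, Finset.card_univ, Fintype.card_prod, ZMod.card, Finset.card_product,
      Finset.card_range]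
    refine lt_of_pow_lt_pow_left₀ 2 (Nat.zero_le _) ?_
    calc (a * (b * c)) ^ 2 = (b * c) * (a * c) * (a * b) := by ring
      _ < (X + 1) ^ 2 * (Y + 1) ^ 2 * (Z + 1) ^ 2 := by gcongr
      _ = _ := by ring
  obtain ⟨v, hv, v', hv', hne, hF⟩ :=
    Finset.exists_ne_map_eq_of_card_lt_of_maps_to hcard (f := F) (fun _ _ => Finset.mem_univ _)
  obtain ⟨v1, v2, v3⟩ := v
  obtain ⟨w1, w2, w3⟩ := v'
  simp only [s, Finset.mem_product, Finset.mem_range] at hv hv'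
  simp only [F, Prod.mk.injEq] at hF
  obtain ⟨hFa, hFb, hFc⟩ := hF
  obtain ⟨x, hx⟩ : ∃ x : ℤ, x = v1 - w1 := ⟨_, rfl⟩
  obtain ⟨y, hy⟩ : ∃ y : ℤ, y = v2 - w2 := ⟨_, rfl⟩
  obtain ⟨z, hz⟩ : ∃ z : ℤ, z = v3 - w3 := ⟨_, rfl⟩
  have hxX : x ^ 2 ≤ b * c := by
    have : x ^ 2 ≤ (X : ℤ) ^ 2 := sq_le_sq' (by omega) (by omega)
    exact this.trans (by exact_mod_cast hX')
  have hyY : y ^ 2 ≤ a * c := by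
    have : y ^ 2 ≤ (Y : ℤ) ^ 2 := sq_le_sq' (by omega) (by omega)
    exact this.trans (by exact_mod_cast hY')
  have hzZ : z ^ 2 < a * b := by
    have : z ^ 2 ≤ (Z : ℤ) ^ 2 := sq_le_sq' (by omega) (by omega)
    exact this.trans_lt (by exact_mod_cast hZ')
  have hnz : ¬ (x = 0 ∧ y = 0 ∧ z = 0) := by
    rintro ⟨rfl, rfl, rfl⟩
    apply hne
    simp only [Prod.mk.injEq]
    omega
  have da : (a : ℤ) ∣ y - e₁ * z := by
    rw [← ZMod.intCast_zmod_eq_zero_iff_dvd] 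
    subst hy hz
    push_cast
    linear_combination hFa
  have db : (b : ℤ) ∣ x - e₂ * z := by
    rw [← ZMod.intCast_zmod_eq_zero_iff_dvd] 
    subst hx hz
    push_cast
    linear_combination hFb
  have dc : (c : ℤ) ∣ x - e₃ * y := by
    rw [← ZMod.intCast_zmod_eq_zero_iff_dvd] 
    subst hx hy
    push_cast
    linear_combination hFc
  have Da : (a : ℤ) ∣ a * x ^ 2 + b * y ^ 2 - c * z ^ 2 := by
    have : (a : ℤ) * x ^ 2 + b * y ^ 2 - c * z ^ 2 =
      a * x ^ 2 + (y - e₁ * z) * (b * (y + e₁ * z)) + (b * e₁ ^ 2 - c) * z ^ 2 := by ring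
    rw [this]
    exact ((dvd_mul_right _ _).add (da.mul_right _)).add (h₁.mul_right _)
  have Db : (b : ℤ) ∣ a * x ^ 2 + b * y ^ 2 - c * z ^ 2 := by
    have : (a : ℤ) * x ^ 2 + b * y ^ 2 - c * z ^ 2 =
      b * y ^ 2 + (x - e₂ * z) * (a * (x + e₂ * z)) + (a * e₂ ^ 2 - c) * z ^ 2 := by ring
    rw [this]
    exact ((dvd_mul_right _ _).add (db.mul_right _)).add (h₂.mul_right _)
  have Dc : (c : ℤ) ∣ a * x ^ 2 + b * y ^ 2 - c * z ^ 2 := by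
    have : (a : ℤ) * x ^ 2 + b * y ^ 2 - c * z ^ 2 =
      c * (- z ^ 2) + (x - e₃ * y) * (a * (x + e₃ * y)) + (a * e₃ ^ 2 + b) * y ^ 2 := by ring
    rw [this]
    exact ((dvd_mul_right _ _).add (dc.mul_right _)).add (h₃.mul_right _)
  have D : ((a : ℤ) * b * c) ∣ a * x ^ 2 + b * y ^ 2 - c * z ^ 2 := by
    refine IsCoprime.mul_dvd (IsCoprime.mul_left ?_ ?_) (IsCoprime.mul_dvd ?_ Da Db) Dc
    all_goals exact Nat.isCoprime_iff_coprime.2 (by assumption)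
  obtain ⟨k, hk⟩ := D
  have ha' : (0 : ℤ) < a := by exact_mod_cast ha
  have hb' : (0 : ℤ) < b := by exact_mod_cast hb
  have hc' : (0 : ℤ) < c := by exact_mod_cast hc
  have hP : (0 : ℤ) < a * b * c := by positivity
  have hk1 : -1 < k := by
    have h : (a * b * c : ℤ) * (-1) < a * b * c * k := by
      rw [← hk]
      have := mul_nonneg ha'.le (sq_nonneg x)
      have := mul_nonneg hb'.le (sq_nonneg y)
      have := mul_lt_mul_of_pos_left hzZ hc'
      linarith
    exact lt_of_mul_lt_mul_left h hP.le
  have hk2 : k ≤ 2 := by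
    have h : (a * b * c : ℤ) * k ≤ a * b * c * 2 := by
      rw [← hk]
      have := mul_nonneg hc'.le (sq_nonneg z)
      have := mul_le_mul_of_nonneg_left hxX ha'.le
      have := mul_le_mul_of_nonneg_left hyY hb'.le
      linarith
    exact le_of_mul_le_mul_left h hP
  -- The form equals `k * abc`. For `k = 1`, multiplicativity helps: `a(xz + by)² + b(yz - ax)² =
  -- (ax² + by²)(z² + ab)`, and the first factor is `c(z² + ab)`. For `k = 2` all bounds are
  -- attained, which forces `x² = bc`.
  obtain rfl | rfl | rfl : k = 0 ∨ k = 1 ∨ k = 2 := by omega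
  · exact ⟨x, y, z, hnz, by linarith⟩
  · refine ⟨x * z + b * y, y * z - a * x, z ^ 2 + a * b, fun h => ?_, ?_⟩
    · have : 0 < z ^ 2 + (a : ℤ) * b := by positivity
      omega
    · linear_combination (z ^ 2 + (a : ℤ) * b) * hk
  · have hx2 : x ^ 2 = b * c := by
      refine le_antisymm hxX ?_
      by_contra! hlt
      have := mul_nonneg hc'.le (sq_nonneg z)
      have := mul_lt_mul_of_pos_left hlt ha'
      have := mul_le_mul_of_nonneg_left hyY hb'.le
      linarith
    refine ⟨0, c, x, fun h => hc'.ne' h.2.1, ?_⟩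
    linear_combination - (c : ℤ) * hx2

/-- Reciprocity twice: `(m/t) = (t/m) = (p/m) = (m/p) = 1`. Moreover `(p/t) = (t/p) = 1`, and `-1`
is a square because `t ≡ 1` modulo 4. -/
theorem isSquare_neg_mul_of_jacobi {p m t : ℕ} [Fact t.Prime] (hp : p.Prime) (hp2 : p ≠ 2)
    (ht4 : t % 4 = 1) (htp : t ≡ 1 [MOD p]) (htm : t ≡ p [MOD m]) (hm4 : m % 4 = 1)
    (hmp : m ≡ 1 [MOD p]) : IsSquare ((-(m * p : ℕ) : ℤ) : ZMod t) := by
  have hpo : Odd p := hp.odd_of_ne_two hp2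
  have hmo : Odd m := Nat.odd_iff.2 (by omega)
  have hto : Odd t := Nat.odd_iff.2 (by omega)
  have e1 : jacobiSym (m : ℤ) p = 1 := by
    have : (m : ℤ) % p = (1 : ℤ) % p := by exact_mod_cast hmp
    rw [jacobiSym.mod_left' this, jacobiSym.one_left]
  have e2 : jacobiSym (m : ℤ) t = 1 := by
    rw [jacobiSym.quadratic_reciprocity_one_mod_four' hmo ht4]
    have : (t : ℤ) % m = (p : ℤ) % m := by exact_mod_cast htm
    rw [jacobiSym.mod_left' this, jacobiSym.quadratic_reciprocity_one_mod_four' hpo hm4, e1]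
  have e3 : jacobiSym (p : ℤ) t = 1 := by
    rw [jacobiSym.quadratic_reciprocity_one_mod_four' hpo ht4]
    have : (t : ℤ) % p = (1 : ℤ) % p := by exact_mod_cast htp
    rw [jacobiSym.mod_left' this, jacobiSym.one_left]
  have e4 : jacobiSym (-(m * p : ℕ) : ℤ) t = 1 := by
    rw [jacobiSym.neg _ hto, ZMod.χ₄_nat_one_mod_four ht4]
    push_cast
    rw [jacobiSym.mul_left, e2, e3]; norm_num
  rw [← jacobiSym.legendreSym.to_jacobiSym] at e4
  have h0 : ((-(m * p : ℕ) : ℤ) : ZMod t) ≠ 0 := by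
    intro h0
    rw [(legendreSym.eq_zero_iff t _).2 h0] at e4
    exact zero_ne_one e4
  exact (legendreSym.eq_one_iff t h0).1 e4

theorem isSquare_prime_of_one_mod {q t : ℕ} [Fact t.Prime] (hq : q.Prime) (hq2 : q ≠ 2)
    (ht4 : t % 4 = 1) (htq : t ≡ 1 [MOD q]) : IsSquare (q : ZMod t) := by
  have hqo : Odd q := hq.odd_of_ne_two hq2
  have e3 : jacobiSym (q : ℤ) t = 1 := by
    rw [jacobiSym.quadratic_reciprocity_one_mod_four' hqo ht4]
    have : (t : ℤ) % q = (1 : ℤ) % q := by exact_mod_cast htq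
    rw [jacobiSym.mod_left' this, jacobiSym.one_left]
  rw [← jacobiSym.legendreSym.to_jacobiSym] at e3
  have h0 : ((q : ℤ) : ZMod t) ≠ 0 := by
    intro h0
    rw [(legendreSym.eq_zero_iff t _).2 h0] at e3
    exact zero_ne_one e3
  simpa using (legendreSym.eq_one_iff t h0).1 e3

/-! ### A Diophantine condition for `p`-integrality -/

/-- The values of `x` for which `1 + 4pq(p-1)x²` is represented by `u² - q v² - p z²`. -/
def QuadIntegral (p q : ℕ) (x : ℚ) : Prop :=
  ∃ u v z : ℚ, u ^ 2 - q * v ^ 2 - p * z ^ 2 = 1 + 4 * p * q * (p - 1) * x ^ 2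

/-- Write `m` for the right-hand side. An auxiliary prime `t` splits the quaternary problem into two
conics: `t` is represented by `u² - q v²`, and `m` by `t u² - p z²`. Substituting the first into the
second represents `m`. The factor `4pq` makes `m ≡ 1` modulo 4 and `p` and keeps `m` prime to `q`;
`p - 1` is a positive substitute for `-1` modulo `p`. -/
theorem quadIntegral_intCast {p q : ℕ} (hp : p.Prime) (hp2 : p ≠ 2) (hq : q.Prime)
    (hq4 : q % 4 = 1) (hqp : q ≠ p) (n : ℤ) : QuadIntegral p q n := by
  obtain ⟨m, hm⟩ : ∃ m : ℕ, m = 1 + 4 * p * q * (p - 1) * n.natAbs ^ 2 := ⟨_, rfl⟩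
  have hm4 : m % 4 = 1 := by
    rw [hm]; simp only [mul_assoc]; omega
  have hmp : m ≡ 1 [MOD p] := by
    have : m = 1 + p * (4 * q * (p - 1) * n.natAbs ^ 2) := by rw [hm]; ring
    rw [this]; simp [Nat.ModEq]
  have hm0 : 0 < m := by omega
  have hcop : Nat.Coprime m (4 * p * q) := by
    have : m = 1 + (4 * p * q) * ((p - 1) * n.natAbs ^ 2) := by rw [hm]; ring
    rw [this]; simp
  have hcm : Nat.Coprime (4 * p * q) m := hcop.symm
  have hmpc : Nat.Coprime m p := Nat.Coprime.coprime_dvd_right ⟨4 * q, by ring⟩ hcop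
  obtain ⟨k, hk1, hk2⟩ := Nat.chineseRemainder hcm 1 p
  have hkc : Nat.Coprime k (4 * p * q * m) := by
    apply Nat.Coprime.mul_right
    · rw [Nat.Coprime, hk1.gcd_eq]; simp
    · rw [Nat.Coprime, hk2.gcd_eq]; exact hmpc.symm
  have hq0 := hq.pos
  have hp0 := hp.pos
  -- Dirichlet's theorem with `t ≡ 1` modulo `4pq` and `t ≡ p` modulo `m`: these are the local
  -- conditions for both conics. The size bound makes `t` differ from `p` and `q`.
  obtain ⟨t, htgt, ht, htk⟩ := Nat.forall_exists_prime_gt_and_modEq (p + q + m)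
    (q := 4 * p * q * m) (by positivity) hkc
  have ht1 : t ≡ 1 [MOD 4 * p * q] := (htk.of_mul_right m).trans hk1
  have htm : t ≡ p [MOD m] := (htk.of_mul_left (4 * p * q)).trans hk2
  have ht4 : t % 4 = 1 := by
    have : t ≡ 1 [MOD 4] := ht1.of_dvd ⟨p * q, by ring⟩
    exact this
  have htp : t ≡ 1 [MOD p] := ht1.of_dvd ⟨4 * q, by ring⟩
  have htq : t ≡ 1 [MOD q] := ht1.of_dvd ⟨4 * p, by ring⟩
  have : Fact t.Prime := ⟨ht⟩
  have hq2 : q ≠ 2 := by rintro rfl; omega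
  have ctq : t.Coprime q := (Nat.coprime_primes ht hq).2 (by omega)
  have ctp : t.Coprime p := (Nat.coprime_primes ht hp).2 (by omega)
  have ctm : t.Coprime m := by
    rw [Nat.Coprime, htm.gcd_eq]; exact hmpc.symm
  obtain ⟨x₁, y₁, z₁, hn₁, h₁⟩ : ∃ x y z : ℤ, ¬ (x = 0 ∧ y = 0 ∧ z = 0) ∧
      (q : ℤ) * x ^ 2 + t * y ^ 2 = (1 : ℕ) * z ^ 2 := by
    obtain ⟨r, hr⟩ := isSquare_prime_of_one_mod hq hq2 ht4 htq
    have hq0 : (q : ZMod t) ≠ 0 := by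
      rw [Ne, ZMod.natCast_eq_zero_iff]
      exact (Nat.Prime.coprime_iff_not_dvd ht).1 ctq
    refine exists_point_on_conic hq.pos ht.pos one_pos ctq.symm (by simp) (by simp)
      (not_isSquare_prime_mul hq ((Nat.Prime.coprime_iff_not_dvd hq).1 ctq.symm))
      (e₁ := 1) (e₂ := ((r⁻¹).val : ℤ)) (e₃ := 0) ?_ ?_ (by simp)
    · have := (Nat.modEq_iff_dvd.1 htq.symm)
      simpa using this
    · rw [← ZMod.intCast_zmod_eq_zero_iff_dvd]
      push_cast
      rw [ZMod.natCast_zmod_val, hr]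
      have : r ≠ 0 := by rintro rfl; simp at hr; exact hq0 hr
      field_simp
      ring
  obtain ⟨x₂, y₂, z₂, hn₂, h₂⟩ : ∃ x y z : ℤ, ¬ (x = 0 ∧ y = 0 ∧ z = 0) ∧
      (p : ℤ) * x ^ 2 + m * y ^ 2 = t * z ^ 2 := by
    obtain ⟨r, hr⟩ := isSquare_neg_mul_of_jacobi hp hp2 ht4 htp htm hm4 hmp
    have hp0 : (p : ZMod t) ≠ 0 := by
      rw [Ne, ZMod.natCast_eq_zero_iff]
      exact (Nat.Prime.coprime_iff_not_dvd ht).1 ctp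
    refine exists_point_on_conic hp.pos hm0 ht.pos hmpc.symm ctp.symm ctm.symm
      (not_isSquare_prime_mul hp ((Nat.Prime.coprime_iff_not_dvd hp).1 hmpc.symm))
      (e₁ := 1) (e₂ := 1) (e₃ := ((r * (p : ZMod t)⁻¹).val : ℤ)) ?_ ?_ ?_
    · have := (Nat.modEq_iff_dvd.1 (htp.trans hmp.symm))
      simpa using this
    · have := (Nat.modEq_iff_dvd.1 htm)
      simpa using this
    · rw [← ZMod.intCast_zmod_eq_zero_iff_dvd]
      push_cast at hr ⊢
      rw [ZMod.natCast_zmod_val]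
      field_simp
      linear_combination - hr
  have hy₁ : y₁ ≠ 0 := by
    rintro rfl
    have hsq : IsSquare ((q * 1 : ℕ) : ℚ) := by
      have hx : (x₁ : ℚ) ≠ 0 := by
        intro hx
        have hx : x₁ = 0 := by exact_mod_cast hx
        subst hx
        exact hn₁ ⟨rfl, rfl, by simpa using h₁.symm⟩
      refine ⟨z₁ / x₁, ?_⟩
      have h₁' : (q : ℚ) * x₁ ^ 2 + t * 0 ^ 2 = (1 : ℕ) * z₁ ^ 2 := by exact_mod_cast h₁
      field_simp
      push_cast at *
      linarith
    exact not_isSquare_prime_mul hq (Nat.Prime.not_dvd_one hq) (Rat.isSquare_natCast_iff.1 hsq)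
  have hy₂ : y₂ ≠ 0 := by
    rintro rfl
    have hsq : IsSquare ((p * t : ℕ) : ℚ) := by
      have hx : (z₂ : ℚ) ≠ 0 := by
        intro hx
        have hx : z₂ = 0 := by exact_mod_cast hx
        subst hx
        simp at h₂
        rcases h₂ with h₂ | h₂
        · exact hp.ne_zero h₂
        · exact hn₂ ⟨h₂, rfl, rfl⟩
      refine ⟨p * x₂ / z₂, ?_⟩
      have h₂' : (p : ℚ) * x₂ ^ 2 + m * 0 ^ 2 = t * z₂ ^ 2 := by exact_mod_cast h₂
      field_simp
      push_cast
      linear_combination (-(p : ℚ)) * h₂'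
    exact not_isSquare_prime_mul hp ((Nat.Prime.coprime_iff_not_dvd hp).1 ctp.symm)
      (Rat.isSquare_natCast_iff.1 hsq)
  have hy₁' : (y₁ : ℚ) ≠ 0 := by exact_mod_cast hy₁
  have hy₂' : (y₂ : ℚ) ≠ 0 := by exact_mod_cast hy₂
  have h₁' : (q : ℚ) * x₁ ^ 2 + t * y₁ ^ 2 = z₁ ^ 2 := by
    have := congrArg (Int.cast : ℤ → ℚ) h₁
    push_cast at this
    linarith
  have h₂' : (p : ℚ) * x₂ ^ 2 + m * y₂ ^ 2 = t * z₂ ^ 2 := by exact_mod_cast h₂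
  have hmq : (m : ℚ) = 1 + 4 * p * q * (p - 1) * n ^ 2 := by
    have h1 : ((n.natAbs : ℕ) : ℚ) ^ 2 = (n : ℚ) ^ 2 := by
      rw [Nat.cast_natAbs, ← Int.cast_pow, sq_abs, Int.cast_pow]
    rw [hm]
    push_cast [Nat.cast_sub hp.one_le]
    rw [h1]
  -- From `t = (z₁/y₁)² - q(x₁/y₁)²` and `m = t(z₂/y₂)² - p(x₂/y₂)²`.
  refine ⟨z₁ * z₂ / (y₁ * y₂), x₁ * z₂ / (y₁ * y₂), x₂ / y₂, ?_⟩
  rw [← hmq]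
  field_simp
  linear_combination - (z₂ : ℚ) ^ 2 * h₁' - (y₁ : ℚ) ^ 2 * h₂'

theorem dvd_and_dvd_of_dvd_sq_sub {p q : ℕ} [Fact p.Prime] (hq : ¬ IsSquare (q : ZMod p))
    {a b : ℤ} (h : (p : ℤ) ∣ a ^ 2 - q * b ^ 2) : (p : ℤ) ∣ a ∧ (p : ℤ) ∣ b := by
  rw [← ZMod.intCast_zmod_eq_zero_iff_dvd] at h
  push_cast at h
  have hb : (b : ZMod p) = 0 := by
    by_contra hb
    apply hq
    refine ⟨a / b, ?_⟩
    field_simp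
    linear_combination - h
  rw [hb] at h
  have ha : (a : ZMod p) = 0 := by simpa using h
  exact ⟨(ZMod.intCast_zmod_eq_zero_iff_dvd _ _).1 ha, (ZMod.intCast_zmod_eq_zero_iff_dvd _ _).1 hb⟩

/-- If `p` divides the common denominator, everything is divisible by `p`. -/
theorem dvd_of_quadratic_eq {p q : ℕ} [Fact p.Prime] (hp2 : p ≠ 2)
    (hq : ¬ IsSquare (q : ZMod p)) {u v z x w : ℤ}
    (h : u ^ 2 - q * v ^ 2 - p * z ^ 2 = w ^ 2 + 4 * p * q * (p - 1) * x ^ 2)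
    (hw : (p : ℤ) ∣ w) : (p : ℤ) ∣ u ∧ (p : ℤ) ∣ v ∧ (p : ℤ) ∣ z ∧ (p : ℤ) ∣ x := by
  have hp : p.Prime := Fact.out
  obtain ⟨w, rfl⟩ := hw
  have h1 : (p : ℤ) ∣ u ^ 2 - q * v ^ 2 :=
    ⟨z ^ 2 + p * w ^ 2 + 4 * q * (p - 1) * x ^ 2, by linear_combination h⟩
  obtain ⟨⟨u, rfl⟩, ⟨v, rfl⟩⟩ := dvd_and_dvd_of_dvd_sq_sub hq h1
  have hp0 : (p : ℤ) ≠ 0 := by exact_mod_cast hp.ne_zero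
  -- After division by `p`, the coefficient `4q(p - 1)` reduces to `-4q`, so the non-residue
  -- argument applies a second time.
  have h2 : (p : ℤ) ∣ z ^ 2 - q * (2 * x) ^ 2 :=
    ⟨u ^ 2 - q * v ^ 2 - w ^ 2 - 4 * q * x ^ 2, by
      apply mul_left_cancel₀ hp0
      linear_combination -h⟩
  obtain ⟨hz, hx⟩ := dvd_and_dvd_of_dvd_sq_sub hq h2
  refine ⟨dvd_mul_right _ _, dvd_mul_right _ _, hz, ?_⟩
  have hpp : Prime (p : ℤ) := Nat.prime_iff_prime_int.1 hp
  rcases hpp.dvd_or_dvd hx with h | h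
  · exfalso
    have : p ∣ 2 := by exact_mod_cast h
    exact hp2 ((Nat.prime_dvd_prime_iff_eq hp Nat.prime_two).1 this)
  · exact h

/-- Descent on a common denominator `W` of the four numbers: if `p` divides `W` it divides all
numerators and can be cancelled, so eventually `p` does not divide `W`, hence not `x.den`. -/
theorem QuadIntegral.not_dvd_den {p q : ℕ} [Fact p.Prime] (hp2 : p ≠ 2)
    (hq : ¬ IsSquare (q : ZMod p)) {x : ℚ} (hx : QuadIntegral p q x) : ¬ p ∣ x.den := by
  have hp : p.Prime := Fact.out
  obtain ⟨u, v, z, h⟩ := hx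
  have key : ∀ n : ℕ, ∀ W U V Z X : ℤ, W.natAbs = n → W ≠ 0 → u * W = U → v * W = V →
      z * W = Z → x * W = X → ¬ p ∣ x.den := by
    intro n
    induction n using Nat.strong_induction_on with
    | _ n ih =>
    intro W U V Z X hWn hW hU hV hZ hX
    have hWq : (W : ℚ) ≠ 0 := by exact_mod_cast hW
    by_cases hpW : (p : ℤ) ∣ W
    · have hE : U ^ 2 - q * V ^ 2 - p * Z ^ 2 = W ^ 2 + 4 * p * q * (p - 1) * X ^ 2 := by
        have : (U : ℚ) ^ 2 - q * V ^ 2 - p * Z ^ 2 = W ^ 2 + 4 * p * q * (p - 1) * X ^ 2 := by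
          rw [← hU, ← hV, ← hZ, ← hX]
          linear_combination (W : ℚ) ^ 2 * h
        exact_mod_cast this
      obtain ⟨⟨U, rfl⟩, ⟨V, rfl⟩, ⟨Z, rfl⟩, ⟨X, rfl⟩⟩ := dvd_of_quadratic_eq hp2 hq hE hpW
      obtain ⟨W, rfl⟩ := hpW
      have hp0 : (p : ℚ) ≠ 0 := by exact_mod_cast hp.ne_zero
      have hW0 : W ≠ 0 := by rintro rfl; simp at hW
      push_cast at hU hV hZ hX
      refine ih W.natAbs ?_ W U V Z X rfl hW0 ?_ ?_ ?_ ?_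
      · rw [← hWn, Int.natAbs_mul, Int.natAbs_natCast]
        have := Int.natAbs_pos.2 hW0
        have := hp.two_le
        nlinarith
      all_goals
        apply mul_left_cancel₀ hp0
        linarith
    · intro hd
      apply hpW
      have h1 : (x.den : ℤ) ∣ x.num * W := by
        refine ⟨X, ?_⟩
        have : (x.num : ℚ) * W = x.den * X := by
          rw [← hX, ← Rat.mul_den_eq_num x]; ring
        exact_mod_cast this
      have h2 : IsCoprime (x.den : ℤ) x.num := by
        rw [Int.isCoprime_iff_gcd_eq_one, Int.gcd_comm]
        exact x.reduced
      exact (Int.natCast_dvd_natCast.2 hd).trans (h2.dvd_of_dvd_mul_left h1)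
  have cl : ∀ y : ℚ, ∀ k : ℚ, y * (y.den * k) = y.num * k := fun y k => by
    rw [← mul_assoc, Rat.mul_den_eq_num]
  refine key _ (u.den * v.den * z.den * x.den) (u.num * (v.den * z.den * x.den))
    (v.num * (u.den * z.den * x.den)) (z.num * (u.den * v.den * x.den))
    (x.num * (u.den * v.den * z.den)) rfl ?_ ?_ ?_ ?_ ?_
  · have := u.den_nz; have := v.den_nz; have := z.den_nz; have := x.den_nz
    positivity
  all_goals
    push_cast
    rw [← cl]
    ring

/-- Dirichlet's theorem in the class that is 1 modulo 4 and a chosen non-residue modulo `p`. -/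
theorem exists_prime_not_isSquare {p : ℕ} (hp : p.Prime) (hp2 : p ≠ 2) :
    ∃ q : ℕ, q.Prime ∧ q % 4 = 1 ∧ ¬ IsSquare (q : ZMod p) := by
  have : Fact p.Prime := ⟨hp⟩
  obtain ⟨a, ha⟩ := FiniteField.exists_nonsquare (F := ZMod p)
    (by rw [ZMod.ringChar_zmod_n]; exact hp2)
  have hcop : Nat.Coprime 4 p := by
    have := (Nat.coprime_primes Nat.prime_two hp).2 (Ne.symm hp2)
    exact Nat.Coprime.mul_left this this
  obtain ⟨k, hk1, hk2⟩ := Nat.chineseRemainder hcop 1 a.val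
  have hkc : Nat.Coprime k (4 * p) := by
    apply Nat.Coprime.mul_right
    · rw [Nat.Coprime, hk1.gcd_eq]; simp
    · rw [Nat.Coprime, hk2.gcd_eq, Nat.gcd_comm]
      refine (Nat.Prime.coprime_iff_not_dvd hp).2 fun h => ha ?_
      rw [← ZMod.natCast_eq_zero_iff, ZMod.natCast_zmod_val] at h
      rw [h]; exact IsSquare.zero
  obtain ⟨q, -, hq, hqk⟩ := Nat.forall_exists_prime_gt_and_modEq 0
    (q := 4 * p) (by have := hp.pos; positivity) hkc
  refine ⟨q, hq, (hqk.of_mul_right p).trans hk1, ?_⟩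
  have : (q : ZMod p) = a := by
    rw [(ZMod.natCast_eq_natCast_iff _ _ _).2 ((hqk.of_mul_left 4).trans hk2),
      ZMod.natCast_zmod_val]
  rwa [this]

/-! ### Primitive recursive integer arithmetic -/

/-- The coding of ℤ sends `Int.ofNat n` to `2n` and `Int.negSucc n` to `2n + 1`. Arithmetic is
obtained by writing an integer as the difference of its positive and negative parts. -/
theorem primrec_int_ofNat : Primrec Int.ofNat :=
  Primrec.encode_iff.1 (Primrec.nat_double.of_eq fun _ => rfl)

theorem primrec_int_negSucc : Primrec Int.negSucc :=
  Primrec.encode_iff.1 (Primrec.nat_double_succ.of_eq fun _ => rfl)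

theorem encode_ofNat (n : ℕ) : Encodable.encode (Int.ofNat n) = 2 * n := rfl

theorem encode_negSucc (n : ℕ) : Encodable.encode (Int.negSucc n) = 2 * n + 1 := rfl

theorem primrec_int_toNat : Primrec Int.toNat := by
  have : Primrec fun z : ℤ => if Encodable.encode z % 2 = 0 then Encodable.encode z / 2 else 0 :=
    Primrec.ite (Primrec.eq.comp (Primrec.nat_mod.comp .encode (.const 2)) (.const 0))
      (Primrec.nat_div.comp .encode (.const 2)) (.const 0)
  refine this.of_eq fun z => ?_
  cases z with
  | ofNat n => rw [encode_ofNat]; simp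
  | negSucc n => rw [encode_negSucc]; simp

theorem primrec_int_neg_toNat : Primrec fun z : ℤ => (-z).toNat := by
  have : Primrec fun z : ℤ =>
      if Encodable.encode z % 2 = 0 then 0 else (Encodable.encode z + 1) / 2 :=
    Primrec.ite (Primrec.eq.comp (Primrec.nat_mod.comp .encode (.const 2)) (.const 0))
      (.const 0) (Primrec.nat_div.comp (Primrec.succ.comp .encode) (.const 2))
  refine this.of_eq fun z => ?_
  cases z with
  | ofNat n => rw [encode_ofNat]; simp
  | negSucc n =>
    rw [encode_negSucc, Int.neg_negSucc, if_neg (by omega)]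
    simp only [Int.toNat_natCast]
    omega

theorem primrec_int_subNat : Primrec₂ fun a b : ℕ => (a : ℤ) - b := by
  have : Primrec₂ fun a b : ℕ => if b ≤ a then Int.ofNat (a - b) else Int.negSucc (b - a - 1) :=
    Primrec.ite (Primrec.nat_le.comp .snd .fst) (primrec_int_ofNat.comp Primrec.nat_sub)
      (primrec_int_negSucc.comp (Primrec.nat_sub.comp
        (Primrec.nat_sub.comp .snd .fst) (.const 1)))
  refine this.of_eq fun a b => ?_
  split_ifs with h
  · simp only [Int.ofNat_eq_natCast]; omega
  · rw [Int.negSucc_eq]; omega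

theorem primrec_int_add : Primrec₂ ((· + ·) : ℤ → ℤ → ℤ) := by
  have : Primrec₂ fun a b : ℤ => ((a.toNat + b.toNat : ℕ) : ℤ) - ((-a).toNat + (-b).toNat : ℕ) :=
    primrec_int_subNat.comp
      (Primrec.nat_add.comp (primrec_int_toNat.comp .fst) (primrec_int_toNat.comp .snd))
      (Primrec.nat_add.comp (primrec_int_neg_toNat.comp .fst) (primrec_int_neg_toNat.comp .snd))
  refine this.of_eq fun a b => ?_
  omega

theorem primrec_int_mul : Primrec₂ ((· * ·) : ℤ → ℤ → ℤ) := by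
  have : Primrec₂ fun a b : ℤ =>
      ((a.toNat * b.toNat + (-a).toNat * (-b).toNat : ℕ) : ℤ) -
        (a.toNat * (-b).toNat + (-a).toNat * b.toNat : ℕ) :=
    have h1 := primrec_int_toNat.comp (Primrec.fst (α := ℤ) (β := ℤ))
    have h2 := primrec_int_toNat.comp (Primrec.snd (α := ℤ) (β := ℤ))
    have h3 := primrec_int_neg_toNat.comp (Primrec.fst (α := ℤ) (β := ℤ))
    have h4 := primrec_int_neg_toNat.comp (Primrec.snd (α := ℤ) (β := ℤ))
    primrec_int_subNat.comp
      (Primrec.nat_add.comp (Primrec.nat_mul.comp h1 h2) (Primrec.nat_mul.comp h3 h4))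
      (Primrec.nat_add.comp (Primrec.nat_mul.comp h1 h4) (Primrec.nat_mul.comp h3 h2))
  refine this.of_eq fun a b => ?_
  have ha : a = (a.toNat : ℤ) - (-a).toNat := by omega
  have hb : b = (b.toNat : ℤ) - (-b).toNat := by omega
  conv_rhs => rw [ha, hb]
  push_cast
  ring

theorem primrec_int_natCast : Primrec ((↑) : ℕ → ℤ) := primrec_int_ofNat

theorem primrec_nat_pow : Primrec₂ ((· ^ ·) : ℕ → ℕ → ℕ) :=
  Primrec₂.unpaired'.1 Nat.Primrec.pow

theorem primrecRel_dvd : PrimrecRel ((· ∣ ·) : ℕ → ℕ → Prop) :=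
  (Primrec.eq.comp (Primrec.nat_mod.comp .snd .fst) (.const 0)).of_eq fun _ =>
    (Nat.dvd_iff_mod_eq_zero).symm

theorem PrimrecRel.forall_lt_comp {α : Type*} [Primcodable α] {R : ℕ → α → Prop} {f : α → ℕ}
    (hR : PrimrecRel R) (hf : Primrec f) : PrimrecPred fun a => ∀ x < f a, R x a :=
  ((PrimrecRel.forall_mem_list hR).comp (Primrec.list_range.comp hf) .id).of_eq fun a => by simp

theorem primrecPred_prime : PrimrecPred Nat.Prime := by
  have : PrimrecPred fun n : ℕ => 2 ≤ n ∧ ∀ m < n, m ∣ n → m = 1 := by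
    refine (Primrec.nat_le.comp (.const 2) .id).and (PrimrecRel.forall_lt_comp ?_ .id)
    refine PrimrecPred.of_eq
      ((primrecRel_dvd.comp (Primrec.fst (α := ℕ) (β := ℕ)) .snd).not.or
        (Primrec.eq.comp (Primrec.fst (α := ℕ) (β := ℕ)) (.const 1))) fun p => ?_
    exact imp_iff_not_or.symm
  refine this.of_eq fun n => ?_
  rw [Nat.prime_def_lt]

/-! ### Polynomials as lists of terms -/

/-- Finite lists of terms, representing polynomials as in `polyOfTerms`. -/
abbrev Terms := List (ℤ × List ℕ)

namespace Terms

/-- The value of a list of terms. -/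
def eval {R : Type*} [CommRing R] (x : ℕ → R) (L : Terms) : R :=
  (L.map fun t => (t.1 : R) * (t.2.map x).prod).sum

theorem aeval_polyOfTerms {R : Type*} [CommRing R] (x : ℕ → R) (L : Terms) :
    MvPolynomial.aeval x (polyOfTerms L) = eval x L := by
  simp only [polyOfTerms, eval, map_list_sum, List.map_map]
  congr 1
  apply List.map_congr_left
  intro t _
  simp [map_list_prod, Function.comp_def]

section eval

variable {R : Type*} [CommRing R] (x : ℕ → R)

@[simp] theorem eval_nil : eval x [] = 0 := rfl

@[simp] theorem eval_cons (t : ℤ × List ℕ) (L : Terms) :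
    eval x (t :: L) = t.1 * (t.2.map x).prod + eval x L := by simp [eval]

@[simp] theorem eval_append (L M : Terms) : eval x (L ++ M) = eval x L + eval x M := by
  simp [eval]

theorem map_eval {S : Type*} [CommRing S] (f : R →+* S) (L : Terms) :
    f (eval x L) = eval (fun i => f (x i)) L := by
  induction L with
  | nil => simp
  | cons t L ih => simp [ih, map_list_prod, Function.comp_def]

/-- The product of two lists of terms. -/
def mul (L M : Terms) : Terms := L.flatMap fun s => M.map fun t => (s.1 * t.1, s.2 ++ t.2)

@[simp] theorem eval_mul (L M : Terms) : eval x (mul L M) = eval x L * eval x M := by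
  have h : ∀ s : ℤ × List ℕ, eval x (M.map fun t => (s.1 * t.1, s.2 ++ t.2)) =
      s.1 * (s.2.map x).prod * eval x M := by
    intro s
    induction M with
    | nil => simp
    | cons t M ih => simp [ih]; ring
  induction L with
  | nil => simp [mul]
  | cons s L ih =>
    have : mul (s :: L) M = M.map (fun t => (s.1 * t.1, s.2 ++ t.2)) ++ mul L M := rfl
    rw [this, eval_append, ih, h, eval_cons]; ring

/-- Renaming variables. -/
def rename (f : ℕ → ℕ) (L : Terms) : Terms := L.map fun t => (t.1, t.2.map f)

@[simp] theorem eval_rename (f : ℕ → ℕ) (L : Terms) :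
    eval x (rename f L) = eval (fun i => x (f i)) L := by
  simp [eval, rename, List.map_map, Function.comp_def]

/-- The sum of the squares of a list of polynomials. -/
def sumSq (Ls : List Terms) : Terms := Ls.flatMap fun L => mul L L

theorem eval_sumSq (Ls : List Terms) : eval x (sumSq Ls) = (Ls.map fun L => eval x L ^ 2).sum := by
  induction Ls with
  | nil => simp [sumSq]
  | cons L Ls ih =>
    have : sumSq (L :: Ls) = mul L L ++ sumSq Ls := rfl
    rw [this, eval_append, ih, eval_mul]
    simp [sq]

/-- The product of a list of polynomials. -/
def prod (Ls : List Terms) : Terms := Ls.foldr mul [(1, [])]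

theorem eval_prod (Ls : List Terms) : eval x (prod Ls) = (Ls.map fun L => eval x L).prod := by
  induction Ls with
  | nil => simp [prod]
  | cons L Ls ih =>
    have : prod (L :: Ls) = mul L (prod Ls) := rfl
    rw [this, eval_mul, ih]; simp

/-- A strict upper bound for the variables that occur. -/
def varBound (L : Terms) : ℕ := (L.flatMap Prod.snd).foldr (· + ·) 1

theorem eval_congr {y : ℕ → R} {L : Terms} (h : ∀ i < varBound L, x i = y i) :
    eval x L = eval y L := by
  have h' : ∀ t ∈ L, ∀ i ∈ t.2, x i = y i := by
    intro t ht i hi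
    apply h
    have hm : i ∈ L.flatMap Prod.snd := List.mem_flatMap.2 ⟨t, ht, hi⟩
    have : ∀ l : List ℕ, i ∈ l → i < l.foldr (· + ·) 1 := by
      intro l
      induction l with
      | nil => simp
      | cons a l ih =>
        intro hi
        rcases List.mem_cons.1 hi with rfl | hi
        · have : 1 ≤ l.foldr (· + ·) 1 := by
            clear ih hi
            induction l with
            | nil => simp
            | cons a l ih => simp only [List.foldr_cons]; omega
          simp only [List.foldr_cons]; omega
        · have := ih hi
          simp only [List.foldr_cons]; omega
    exact this _ hm
  unfold eval
  congr 1
  apply List.map_congr_left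
  intro t ht
  congr 2
  exact List.map_congr_left fun i hi => h' t ht i hi

/-- An upper bound for the total degree. -/
def degBound (L : Terms) : ℕ := (L.map fun t => t.2.length).foldr max 0

/-- Homogenisation: the new variable gets the index `0`, all others are shifted. -/
def homogenize (L : Terms) : Terms :=
  L.map fun t => (t.1, t.2.map Nat.succ ++ (List.range (degBound L - t.2.length)).map fun _ => 0)

end eval

theorem length_le_degBound {L : Terms} {t : ℤ × List ℕ} (h : t ∈ L) : t.2.length ≤ degBound L := by
  unfold degBound
  induction L with
  | nil => simp at h
  | cons s L ih =>
    simp only [List.map_cons, List.foldr_cons]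
    rcases List.mem_cons.1 h with rfl | h
    · exact le_max_left _ _
    · exact (ih h).trans (le_max_right _ _)

theorem eval_homogenize {K : Type*} [Field K] (y : ℕ → K) (hy : y 0 ≠ 0) (L : Terms) :
    eval y (homogenize L) = y 0 ^ degBound L * eval (fun i => y (i + 1) / y 0) L := by
  unfold eval homogenize
  rw [List.map_map, ← List.sum_map_mul_left]
  congr 1
  apply List.map_congr_left
  intro t ht
  have h1 : ((t.2.map fun i => y (i + 1) / y 0)).prod =
      (t.2.map fun i => y (i + 1)).prod / y 0 ^ t.2.length := by
    induction t.2 with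
    | nil => simp
    | cons a l ih => simp [ih, pow_succ]; field_simp
  have h2 : y 0 ^ degBound L = y 0 ^ (degBound L - t.2.length) * y 0 ^ t.2.length := by
    rw [← pow_add, Nat.sub_add_cancel (length_le_degBound ht)]
  simp only [Function.comp_apply, List.map_append, List.map_map, List.prod_append, h1, h2]
  have h3 : ∀ n : ℕ, (List.map (y ∘ fun _ : ℕ => 0) (List.range n)).prod = y 0 ^ n := by
    intro n; simp [Function.comp_def]
  rw [h3]
  have : y 0 ^ t.2.length ≠ 0 := pow_ne_zero _ hy
  field_simp
  rfl

/-! #### Primitive recursiveness -/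

theorem primrec_ofNat : Primrec (Denumerable.ofNat Terms) :=
  Primrec.option_some_iff.1 (Primrec.decode.of_eq fun n => Denumerable.decode_eq_ofNat _ n)

theorem primrec_mul : Primrec₂ mul := by
  refine Primrec.list_flatMap .fst ?_
  refine Primrec.list_map (Primrec.snd.comp .fst) ?_
  have hs : Primrec fun q : ((Terms × Terms) × (ℤ × List ℕ)) × (ℤ × List ℕ) => q.1.2 :=
    Primrec.snd.comp .fst
  have ht : Primrec fun q : ((Terms × Terms) × (ℤ × List ℕ)) × (ℤ × List ℕ) => q.2 :=
    Primrec.snd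
  exact (primrec_int_mul.comp (Primrec.fst.comp hs) (Primrec.fst.comp ht)).pair
    (Primrec.list_append.comp (Primrec.snd.comp hs) (Primrec.snd.comp ht))

theorem primrec_rename {α : Type*} [Primcodable α] {f : α → ℕ → ℕ} {L : α → Terms}
    (hf : Primrec₂ f) (hL : Primrec L) : Primrec fun a => rename (f a) (L a) := by
  refine Primrec.list_map hL ?_
  refine (Primrec.fst.comp .snd).pair (Primrec.list_map (Primrec.snd.comp .snd) ?_)
  exact hf.comp (Primrec.fst.comp .fst) .snd

theorem primrec_sumSq : Primrec sumSq :=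
  Primrec.list_flatMap .id (primrec_mul.comp .snd .snd)

theorem primrec_prod : Primrec prod :=
  Primrec.list_foldr .id (.const _)
    (primrec_mul.comp (Primrec.fst.comp .snd) (Primrec.snd.comp .snd)).to₂

theorem primrec_varBound : Primrec varBound :=
  Primrec.list_foldr (Primrec.list_flatMap .id (Primrec.snd.comp .snd).to₂) (.const 1)
    (Primrec.nat_add.comp (Primrec.fst.comp .snd) (Primrec.snd.comp .snd)).to₂

theorem primrec_degBound : Primrec degBound :=
  Primrec.list_foldr (Primrec.list_map .id (Primrec.list_length.comp (Primrec.snd.comp .snd)).to₂)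
    (.const 0) (Primrec.nat_max.comp (Primrec.fst.comp .snd) (Primrec.snd.comp .snd)).to₂

theorem primrec_homogenize : Primrec homogenize := by
  refine Primrec.list_map .id ?_
  refine (Primrec.fst.comp .snd).pair (Primrec.list_append.comp ?_ ?_)
  · exact Primrec.list_map (Primrec.snd.comp .snd) (Primrec.succ.comp .snd)
  · refine Primrec.list_map (Primrec.list_range.comp (Primrec.nat_sub.comp
      (primrec_degBound.comp .fst) (Primrec.list_length.comp (Primrec.snd.comp .snd)))) (.const 0)

theorem primrec_eval_list :
    Primrec₂ fun (v : List ℤ) (L : Terms) => eval (fun i => v.getD i 0) L := by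
  have hprod : Primrec₂ fun (v : List ℤ) (l : List ℕ) => (l.map fun i => v.getD i 0).prod := by
    refine Primrec.list_foldr (Primrec.list_map .snd ?_) (.const 1)
      (primrec_int_mul.comp (Primrec.fst.comp .snd) (Primrec.snd.comp .snd)).to₂
    exact (Primrec.list_getD 0).comp (Primrec.fst.comp .fst) .snd
  refine Primrec.list_foldr (Primrec.list_map .snd ?_) (.const 0)
      (primrec_int_add.comp (Primrec.fst.comp .snd) (Primrec.snd.comp .snd)).to₂
  exact primrec_int_mul.comp (Primrec.fst.comp .snd)
    (hprod.comp (Primrec.fst.comp .fst) (Primrec.snd.comp .snd))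

end Terms

/-! ### Rational zeros with restricted denominators -/

theorem mem_invertedRing_iff {S : Set ℕ} (hS : ∀ p ∈ S, p.Prime) (x : ℚ) :
    x ∈ invertedRing S ↔ ∀ p : ℕ, p.Prime → p ∣ x.den → p ∈ S := by
  constructor
  · intro hx
    induction hx using Subring.closure_induction with
    | mem x hx =>
      obtain ⟨p, hp, rfl⟩ := hx
      intro l hl hd
      have h0 := (hS p hp).pos
      rw [Rat.inv_natCast_den_of_pos h0] at hd
      rwa [(Nat.prime_dvd_prime_iff_eq hl (hS p hp)).1 hd]
    | zero => intro p hp hd; simp at hd; exact absurd hd hp.ne_one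
    | one => intro p hp hd; simp at hd; exact absurd hd hp.ne_one
    | add x y _ _ hx hy =>
      intro p hp hd
      rcases hp.dvd_mul.1 (hd.trans (Rat.add_den_dvd x y)) with h | h
      · exact hx p hp h
      · exact hy p hp h
    | neg x _ hx => intro p hp hd; exact hx p hp (by simpa using hd)
    | mul x y _ _ hx hy =>
      intro p hp hd
      rcases hp.dvd_mul.1 (hd.trans (Rat.mul_den_dvd x y)) with h | h
      · exact hx p hp h
      · exact hy p hp h
  · have key : ∀ n : ℕ, n ≠ 0 → (∀ p : ℕ, p.Prime → p ∣ n → p ∈ S) →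
        (n : ℚ)⁻¹ ∈ invertedRing S := by
      intro n
      induction n using induction_on_primes with
      | zero => intro h; exact absurd rfl h
      | one => intro _ _; simp
      | prime_mul p a hp ih =>
        intro h0 h
        have ha : a ≠ 0 := by rintro rfl; simp at h0
        have h1 := ih ha fun l hl hd => h l hl (hd.mul_left _)
        have h2 : (p : ℚ)⁻¹ ∈ invertedRing S :=
          Subring.subset_closure ⟨p, h p hp (dvd_mul_right _ _), rfl⟩
        push_cast
        rw [mul_inv]
        exact Subring.mul_mem _ h2 h1
    intro h
    rw [← Rat.num_div_den x, div_eq_mul_inv]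
    exact Subring.mul_mem _ (intCast_mem _ _) (key _ x.den_nz h)

/-- The polynomial given by `L` has a rational zero all of whose denominators are products of
primes satisfying `Q`. -/
def SolvableWith (Q : ℕ → Prop) (L : Terms) : Prop :=
  ∃ x : ℕ → ℚ, (∀ i, ∀ p : ℕ, p.Prime → p ∣ (x i).den → Q p) ∧ Terms.eval x L = 0

theorem SolvableWith.mono {Q Q' : ℕ → Prop} {L : Terms} (h : SolvableWith Q L)
    (hQ : ∀ p : ℕ, p.Prime → Q p → Q' p) : SolvableWith Q' L :=
  let ⟨x, hx, h0⟩ := h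
  ⟨x, fun i p hp hd => hQ p hp (hx i p hp hd), h0⟩

theorem polyOfIndex_eq_polyOfTerms (e : ℕ) :
    polyOfIndex e = polyOfTerms (Denumerable.ofNat Terms e) := rfl

theorem mem_HTP_iff {R : Type*} [CommRing R] {e : ℕ} :
    e ∈ HTP R ↔ ∃ x : ℕ → R, Terms.eval x (Denumerable.ofNat Terms e) = 0 := by
  simp only [HTP, Set.mem_ofPred_eq, polyOfIndex_eq_polyOfTerms, Terms.aeval_polyOfTerms]

theorem encode_mem_HTP_iff {R : Type*} [CommRing R] {L : Terms} :
    Encodable.encode L ∈ HTP R ↔ ∃ x : ℕ → R, Terms.eval x L = 0 := by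
  rw [mem_HTP_iff]
  have : Denumerable.ofNat Terms (Encodable.encode L) = L := Denumerable.ofNat_encode L
  rw [this]

theorem mem_HTP_invertedRing_iff {S : Set ℕ} (hS : ∀ p ∈ S, p.Prime) {e : ℕ} :
    e ∈ HTP (invertedRing S) ↔ SolvableWith (· ∈ S) (Denumerable.ofNat Terms e) := by
  rw [mem_HTP_iff]
  constructor
  · rintro ⟨x, hx⟩
    refine ⟨fun i => x i, fun i => (mem_invertedRing_iff hS _).1 (x i).2, ?_⟩
    have := congrArg (invertedRing S).subtype hx
    rw [Terms.map_eval, map_zero] at this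
    exact this
  · rintro ⟨x, hx, h0⟩
    refine ⟨fun i => ⟨x i, (mem_invertedRing_iff hS _).2 (hx i)⟩, ?_⟩
    apply (invertedRing S).subtype_injective
    rw [Terms.map_eval, map_zero]
    exact h0

/-- The homogenising coordinate serves as a common denominator of the zero. This turns the search
for rational zeros into a search through finite integer vectors with a condition on one entry only.
-/
theorem solvableWith_iff_exists_list {Q : ℕ → Prop} {L : Terms} :
    SolvableWith Q L ↔ ∃ v : List ℤ, v.getD 0 0 ≠ 0 ∧
      (∀ p : ℕ, p.Prime → p ∣ (v.getD 0 0).natAbs → Q p) ∧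
      Terms.eval (fun i => v.getD i 0) (Terms.homogenize L) = 0 := by
  constructor
  · rintro ⟨x, hx, h0⟩
    set N := Terms.varBound L + Terms.varBound (Terms.homogenize L) with hN
    set w : ℕ := ∏ i ∈ Finset.range N, (x i).den with hw
    have hw0 : w ≠ 0 := Finset.prod_ne_zero_iff.2 fun i _ => (x i).den_nz
    have hxw : ∀ i < N, ∃ n : ℤ, (n : ℚ) = x i * w := by
      intro i hi
      obtain ⟨k, hk⟩ := Finset.dvd_prod_of_mem (fun i => (x i).den) (Finset.mem_range.2 hi)
      refine ⟨(x i).num * k, ?_⟩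
      have hk' : w = (x i).den * k := hk
      rw [hk']
      push_cast
      rw [← mul_assoc, Rat.mul_den_eq_num]
    have hxw' : ∀ i, ∃ n : ℤ, i < N → (n : ℚ) = x i * w := by
      intro i
      by_cases hi : i < N
      · obtain ⟨n, hn⟩ := hxw i hi
        exact ⟨n, fun _ => hn⟩
      · exact ⟨0, fun h => absurd h hi⟩
    choose n hn using hxw'
    refine ⟨(w : ℤ) :: (List.range N).map n, by simpa using hw0, ?_, ?_⟩
    · intro p hp hd
      simp only [List.getD_cons_zero, Int.natAbs_natCast] at hd
      obtain ⟨i, -, hi⟩ := (Prime.dvd_finsetProd_iff hp.prime _).1 hd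
      exact hx i p hp hi
    · have hw0' : (w : ℚ) ≠ 0 := by exact_mod_cast hw0
      have hmap := Terms.map_eval (fun i => ((w : ℤ) :: (List.range N).map n).getD i 0)
        (Int.castRingHom ℚ) (Terms.homogenize L)
      have : Terms.eval (fun i => Int.castRingHom ℚ (((w : ℤ) :: (List.range N).map n).getD i 0))
          (Terms.homogenize L) = 0 := by
        rw [Terms.eval_homogenize _ (by simpa using hw0')]
        rw [Terms.eval_congr (y := x), h0, mul_zero]
        intro i hi
        have hiN : i < N := by omega
        simp only [List.getD_cons_succ, List.getD_cons_zero]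
        rw [List.getD_eq_getElem _ _ (by simpa using hiN)]
        simp only [List.getElem_map, List.getElem_range, eq_intCast, hn i hiN, Int.cast_natCast]
        field_simp
      rw [this] at hmap
      exact (Int.cast_eq_zero (α := ℚ)).1 hmap
  · rintro ⟨v, hv0, hv, h0⟩
    have hv0' : ((v.getD 0 0 : ℤ) : ℚ) ≠ 0 := by exact_mod_cast hv0
    refine ⟨fun i => (v.getD (i + 1) 0 : ℤ) / (v.getD 0 0 : ℤ), ?_, ?_⟩
    · intro i p hp hd
      refine hv p hp (hd.trans ?_)
      rw [← Int.natCast_dvd]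
      have := Rat.den_dvd (v.getD (i + 1) 0) (v.getD 0 0)
      rwa [Rat.divInt_eq_div] at this
    · have hmap := Terms.map_eval (fun i => v.getD i 0) (Int.castRingHom ℚ) (Terms.homogenize L)
      rw [h0, Terms.eval_homogenize _ (by simpa using hv0'), map_zero] at hmap
      refine (mul_eq_zero.1 hmap.symm).resolve_left ?_
      exact pow_ne_zero _ (by simpa using hv0')

theorem Terms.eval_sumSq_eq_zero_iff {x : ℕ → ℚ} {Ls : List Terms} :
    eval x (sumSq Ls) = 0 ↔ ∀ L ∈ Ls, eval x L = 0 := by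
  rw [eval_sumSq]
  induction Ls with
  | nil => simp
  | cons L Ls ih =>
    have h : 0 ≤ (Ls.map fun L => eval x L ^ 2).sum :=
      List.sum_nonneg (by simp only [List.mem_map]; rintro _ ⟨L, -, rfl⟩; positivity)
    simp only [List.map_cons, List.sum_cons, List.forall_mem_cons]
    rw [add_eq_zero_iff_of_nonneg (sq_nonneg _) h, ih, pow_eq_zero_iff two_ne_zero]

/-! ### Reducing solvability in `ℚ` to solvability in a subring -/

/-- The homogenisation of `L` together with a condition saying, in any subring of `ℚ`, that the
homogenising variable is not zero. -/
def nonzeroTerms (L : Terms) : Terms :=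
  Terms.sumSq [Terms.rename (· + 6) (Terms.homogenize L),
    [(1, [6, 6, 0, 0]), (-1, []), (-1, [1, 1]), (-1, [2, 2]), (-1, [3, 3]), (-1, [4, 4])]]

theorem primrec_nonzeroTerms : Primrec nonzeroTerms := by
  refine Terms.primrec_sumSq.comp (Primrec.list_cons.comp ?_ (.const _))
  exact Terms.primrec_rename (Primrec.nat_add.comp .snd (.const 6)).to₂ Terms.primrec_homogenize

/-- The extra equation is `w²y² = 1 + a² + b² + c² + d²`, with `w` the homogenising variable. Over ℚ
it excludes `w = 0`. For an integer `w ≠ 0` Lagrange's theorem solves it with `y = 1`, so a rational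
zero yields an integral solution, available in every `R`. -/
theorem exists_eval_nonzeroTerms_iff {R : Type*} [CommRing R] (f : R →+* ℚ)
    {L : Terms} :
    (∃ x : ℕ → R, Terms.eval x (nonzeroTerms L) = 0) ↔ ∃ x : ℕ → ℚ, Terms.eval x L = 0 := by
  constructor
  · rintro ⟨x, hx⟩
    have h := congrArg f hx
    rw [Terms.map_eval, map_zero, nonzeroTerms, Terms.eval_sumSq_eq_zero_iff] at h
    simp only [List.forall_mem_cons, Terms.eval_rename, Terms.eval_cons, Terms.eval_nil,
      List.map_cons, List.map_nil, List.prod_cons, List.prod_nil] at h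
    obtain ⟨h1, h2, -⟩ := h
    have h0 : f (x (0 + 6)) ≠ 0 := by
      intro h0
      simp only [zero_add] at h0
      rw [h0] at h2
      push_cast at h2
      nlinarith [sq_nonneg (f (x 1)), sq_nonneg (f (x 2)), sq_nonneg (f (x 3)), sq_nonneg (f (x 4))]
    rw [Terms.eval_homogenize _ h0] at h1
    exact ⟨_, (mul_eq_zero.1 h1).resolve_left (pow_ne_zero _ h0)⟩
  · rintro ⟨x, hx⟩
    obtain ⟨v, hv0, -, hv⟩ := solvableWith_iff_exists_list.1
      (⟨x, fun _ _ _ _ => trivial, hx⟩ : SolvableWith (fun _ => True) L)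
    obtain ⟨a, b, c, d, h4⟩ := Nat.sum_four_squares ((v.getD 0 0).natAbs ^ 2 - 1)
    have h1 : 1 ≤ (v.getD 0 0).natAbs ^ 2 := Nat.one_le_pow _ _ (Int.natAbs_pos.2 hv0)
    have h4' : (a : ℤ) ^ 2 + b ^ 2 + c ^ 2 + d ^ 2 = v.getD 0 0 ^ 2 - 1 := by
      have := congrArg (Nat.cast : ℕ → ℤ) h4
      rw [Nat.cast_sub h1] at this
      push_cast at this
      rw [this, sq_abs]
    refine ⟨fun i => Int.castRingHom R
      (((1 : ℤ) :: (a : ℤ) :: (b : ℤ) :: (c : ℤ) :: (d : ℤ) :: 0 :: v).getD i 0), ?_⟩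
    rw [← Terms.map_eval, nonzeroTerms, Terms.eval_sumSq]
    simp only [List.map_cons, List.map_nil, Terms.eval_rename, List.getD_cons_succ, hv,
      Terms.eval_cons, Terms.eval_nil, List.prod_cons, List.prod_nil, List.getD_cons_zero,
      List.sum_cons, List.sum_nil]
    generalize v.getD 0 0 = w at h4'
    have h5 := congrArg (Int.castRingHom R) h4'
    simp only [map_add, map_sub, map_pow, map_mul, map_zero, map_one, map_neg, Int.cast_id]
      at h5 ⊢
    linear_combination (-((Int.castRingHom R w) ^ 2 - 1 - (Int.castRingHom R a) ^ 2 -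
      (Int.castRingHom R b) ^ 2 - (Int.castRingHom R c) ^ 2 - (Int.castRingHom R d) ^ 2)) * h5

theorem turingReducible_of_manyOne {A B : Set ℕ} {f : ℕ → ℕ} (hf : Computable f)
    (h : ∀ n, n ∈ A ↔ f n ∈ B) : TuringReducible (charFun A) (charFun B) := by
  refine RecursiveIn.iff_nat.2 ?_
  have h1 : Nat.RecursiveIn {charFun B} fun n => (Part.some (f n) : Part ℕ) :=
    RecursiveIn.iff_nat.1 hf.computableIn
  refine ((Nat.RecursiveIn.oracle (charFun B) (Set.mem_singleton _)).comp h1).of_eq fun n => ?_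
  refine (Part.bind_some (f n) (charFun B)).trans ?_
  have hn := h n
  by_cases hA : n ∈ A <;> simp_all [charFun]

theorem HTP_rat_turingReducible (S : Set ℕ) :
    TuringReducible (charFun (HTP ℚ)) (charFun (HTP (invertedRing S))) := by
  refine turingReducible_of_manyOne
    (f := fun e => Encodable.encode (nonzeroTerms (Denumerable.ofNat Terms e)))
    (Primrec.encode.comp (primrec_nonzeroTerms.comp Terms.primrec_ofNat)).to_comp fun e => ?_
  rw [encode_mem_HTP_iff, mem_HTP_iff,
    exists_eval_nonzeroTerms_iff (invertedRing S).subtype]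

/-! ### Reducing solvability in semilocal subrings to solvability in `ℚ` -/

/-- The equation defining `QuadIntegral p q`, in the variables `x, u, v, z`. -/
def quadTerms (p q x u v z : ℕ) : Terms :=
  [(1, [u, u]), (-q, [v, v]), (-p, [z, z]), (-1, []), (-(4 * p * q * (p - 1) : ℕ), [x, x])]

theorem eval_quadTerms_eq_zero_iff {p q x u v z : ℕ} (hp : 1 ≤ p) (y : ℕ → ℚ) :
    Terms.eval y (quadTerms p q x u v z) = 0 ↔
      y u ^ 2 - q * y v ^ 2 - p * y z ^ 2 = 1 + 4 * p * q * (p - 1) * y x ^ 2 := by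
  simp only [quadTerms, Terms.eval_cons, Terms.eval_nil, List.map_cons, List.map_nil,
    List.prod_cons, List.prod_nil]
  push_cast [Nat.cast_sub hp]
  constructor <;> intro h <;> linear_combination h

/-- The system of equations saying that `L` has a zero that is integral at the primes `a.1`, for
`a ∈ A`. -/
def localSystem (L : Terms) (A : List (ℕ × ℕ)) : List Terms :=
  Terms.rename (fun j => Nat.pair (j + 2) 0) (Terms.homogenize L) ::
  [(1, [Nat.pair 2 0, Nat.pair 0 1]), (-1, [])] ::
  [(1, [Nat.pair 2 0, Nat.pair 0 0]), (-1, []),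
    (-((A.map Prod.fst).foldr (· * ·) 1 : ℕ), [Nat.pair 1 0])] ::
  (List.range (Terms.varBound (Terms.homogenize L) + 2)).flatMap fun i =>
    A.map fun a => quadTerms a.1 a.2 (Nat.pair i 0) (Nat.pair i (3 * a.1))
      (Nat.pair i (3 * a.1 + 1)) (Nat.pair i (3 * a.1 + 2))

theorem varBound_pos (L : Terms) : 1 ≤ Terms.varBound L := by
  unfold Terms.varBound
  generalize L.flatMap Prod.snd = l
  induction l with
  | nil => simp
  | cons a l ih => simp only [List.foldr_cons]; omega

theorem den_inv_eq {w : ℚ} (hw : w ≠ 0) : (w⁻¹).den = w.num.natAbs := by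
  rw [Rat.inv_def, Rat.den_divInt]
  simp [hw, Int.gcd, Nat.gcd_comm, Nat.Coprime.gcd_eq_one w.reduced.symm]

theorem not_dvd_den_add {p : ℕ} (hp : p.Prime) {x y : ℚ} (hx : ¬ p ∣ x.den) (hy : ¬ p ∣ y.den) :
    ¬ p ∣ (x + y).den := fun h =>
  (hp.dvd_mul.1 (h.trans (Rat.add_den_dvd x y))).elim hx hy

theorem not_dvd_den_mul {p : ℕ} (hp : p.Prime) {x y : ℚ} (hx : ¬ p ∣ x.den) (hy : ¬ p ∣ y.den) :
    ¬ p ∣ (x * y).den := fun h =>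
  (hp.dvd_mul.1 (h.trans (Rat.mul_den_dvd x y))).elim hx hy

/-- If `p` divided the numerator of `w`, dividing the Bézout relation by `p` would exhibit `1/p` as
a `p`-integral number. -/
theorem not_dvd_den_inv {p : ℕ} (hp : p.Prime) {w c d : ℚ} {P : ℕ} (hpP : p ∣ P)
    (hw : ¬ p ∣ w.den) (hc : ¬ p ∣ c.den) (hd : ¬ p ∣ d.den) (hw0 : w ≠ 0)
    (h : w * c = 1 + P * d) : ¬ p ∣ (w⁻¹).den := by
  rw [den_inv_eq hw0, ← Int.natCast_dvd]
  rintro ⟨k, hk⟩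
  obtain ⟨P', rfl⟩ := hpP
  have hp0 : (p : ℚ) ≠ 0 := by exact_mod_cast hp.ne_zero
  have hwp : w = p * (k / w.den) := by
    conv_lhs => rw [← Rat.num_div_den w, hk]
    push_cast
    ring
  have hk' : ¬ p ∣ ((k : ℚ) / w.den).den := by
    intro h
    have := Rat.den_dvd k w.den
    rw [Rat.divInt_eq_div] at this
    exact hw (h.trans (Int.natCast_dvd_natCast.1 (by exact_mod_cast this)))
  have h1 : ((p : ℚ))⁻¹ = (k / w.den : ℚ) * c + ((-P' : ℤ) : ℚ) * d := by
    refine inv_eq_of_mul_eq_one_right ?_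
    rw [hwp] at h
    push_cast at h ⊢
    linear_combination h
  have h2 : ¬ p ∣ ((p : ℚ)⁻¹).den := by
    rw [h1]
    exact not_dvd_den_add hp (not_dvd_den_mul hp hk' hc)
      (not_dvd_den_mul hp (by rw [Rat.den_intCast]; exact hp.not_dvd_one) hd)
  rw [Rat.inv_natCast_den_of_pos hp.pos] at h2
  exact h2 dvd_rfl

/-- Whether `A` lists odd primes `p`, each with the auxiliary prime `q` that `QuadIntegral`
needs. -/
def Admissible (f : ℕ → ℕ) (A : List (ℕ × ℕ)) : Prop :=
  ∀ a ∈ A, a.1.Prime ∧ a.1 ≠ 2 ∧ a.2 = f a.1 ∧ (f a.1).Prime ∧ f a.1 % 4 = 1 ∧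
    ¬ IsSquare (f a.1 : ZMod a.1)

theorem dvd_foldr_mul {l : List ℕ} {p : ℕ} (h : p ∈ l) : p ∣ l.foldr (· * ·) 1 :=
  List.dvd_prod h

/-- Column 0 of the paired variables holds two Bézout coefficients and then the homogeneous
coordinates, all forced to be integral at the listed primes. The Bézout relation makes the
homogenising coordinate a unit there, so dehomogenising preserves integrality. -/
theorem solvableWith_of_eval_localSystem {f : ℕ → ℕ} {L : Terms} {A : List (ℕ × ℕ)}
    (hA : Admissible f A) {x : ℕ → ℚ} (hx : ∀ M ∈ localSystem L A, Terms.eval x M = 0) :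
    SolvableWith (fun p => p ∉ A.map Prod.fst) L := by
  simp only [localSystem, List.forall_mem_cons, Terms.eval_rename, Terms.eval_cons,
    Terms.eval_nil, List.map_cons, List.map_nil, List.prod_cons, List.prod_nil] at hx
  obtain ⟨h1, h2, h3, h4⟩ := hx
  set K := Terms.varBound (Terms.homogenize L) with hK
  have hK1 : 1 ≤ K := varBound_pos _
  have hint : ∀ i < K + 2, ∀ p ∈ A.map Prod.fst, ¬ p ∣ (x (Nat.pair i 0)).den := by
    intro i hi p hp
    obtain ⟨a, ha, rfl⟩ := List.mem_map.1 hp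
    obtain ⟨hp1, hp2, hq, hq1, hq4, hqs⟩ := hA a ha
    have := h4 _ (List.mem_flatMap.2 ⟨i, List.mem_range.2 hi, List.mem_map.2 ⟨a, ha, rfl⟩⟩)
    rw [eval_quadTerms_eq_zero_iff hp1.one_le] at this
    have : Fact a.1.Prime := ⟨hp1⟩
    rw [← hq] at hqs
    exact QuadIntegral.not_dvd_den hp2 hqs ⟨_, _, _, ‹_›⟩
  have hw0 : x (Nat.pair 2 0) ≠ 0 := by
    intro h
    rw [h] at h2
    norm_num at h2
  have hinv : ∀ p ∈ A.map Prod.fst, ¬ p ∣ ((x (Nat.pair 2 0))⁻¹).den := by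
    intro p hp
    obtain ⟨a, ha, hap⟩ := List.mem_map.1 hp
    have hp1 : p.Prime := hap ▸ (hA a ha).1
    refine not_dvd_den_inv hp1 (dvd_foldr_mul hp) (hint 2 (by omega) p hp)
      (hint 0 (by omega) p hp) (hint 1 (by omega) p hp) hw0 ?_
    push_cast at h3 ⊢
    linear_combination h3
  -- Integrality is imposed on finitely many variables only. The others do not occur in the
  -- polynomial and are replaced by 0.
  set y : ℕ → ℚ := fun j => if j < K then x (Nat.pair (j + 2) 0) else 0 with hy
  have hy0 : y 0 = x (Nat.pair 2 0) := by simp only [hy]; rw [if_pos (by omega)]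
  have hy1 : Terms.eval y (Terms.homogenize L) = 0 := by
    rw [← h1]
    refine Terms.eval_congr _ fun i hi => ?_
    simp only [hy]
    rw [if_pos hi]
  rw [Terms.eval_homogenize _ (by rwa [hy0])] at hy1
  refine ⟨_, fun i p hp hd hpA => ?_,
    (mul_eq_zero.1 hy1).resolve_left (pow_ne_zero _ (by rwa [hy0]))⟩
  rw [div_eq_mul_inv] at hd
  refine not_dvd_den_mul hp ?_ (by rw [hy0]; exact hinv p hpA) hd
  simp only [hy]
  split_ifs with h
  · exact hint _ (by omega) p hpA
  · simpa using hp.ne_one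

theorem exists_eval_localSystem {f : ℕ → ℕ} {L : Terms} {A : List (ℕ × ℕ)}
    (hA : Admissible f A) (h : SolvableWith (fun p => p ∉ A.map Prod.fst) L) :
    ∃ x : ℕ → ℚ, ∀ M ∈ localSystem L A, Terms.eval x M = 0 := by
  obtain ⟨v, hv0, hv, hev⟩ := solvableWith_iff_exists_list.1 h
  set P : ℕ := (A.map Prod.fst).foldr (· * ·) 1 with hP
  have hcop : IsCoprime (v.getD 0 0) (P : ℤ) := by
    rw [Int.isCoprime_iff_gcd_eq_one, Int.gcd, Int.natAbs_natCast]
    refine Nat.Coprime.symm (Nat.coprime_list_prod_left_iff.2 fun p hp => ?_)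
    obtain ⟨a, ha, hap⟩ := List.mem_map.1 hp
    have hp1 : p.Prime := hap ▸ (hA a ha).1
    exact (Nat.Prime.coprime_iff_not_dvd hp1).2 fun hd => hv p hp1 hd hp
  obtain ⟨c, d, hcd⟩ := hcop
  -- The sign of `d` matches the relation `w * c - 1 - P * d' = 0` of the system.
  set b : ℕ → ℤ := fun i => (c :: (-d) :: v).getD i 0 with hb
  have haux : ∀ i p, ∃ g : ℕ → ℚ, p ∈ A.map Prod.fst →
      g 0 ^ 2 - f p * g 1 ^ 2 - p * g 2 ^ 2 = 1 + 4 * p * f p * (p - 1) * (b i : ℚ) ^ 2 := by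
    intro i p
    by_cases hp : p ∈ A.map Prod.fst
    · obtain ⟨a, ha, rfl⟩ := List.mem_map.1 hp
      obtain ⟨hp1, hp2, hq, hq1, hq4, hqs⟩ := hA a ha
      obtain ⟨u, w, z, hu⟩ := quadIntegral_intCast hp1 hp2 hq1 hq4 (by
        intro he; rw [he] at hqs; simp at hqs) (b i)
      exact ⟨fun k => if k = 0 then u else if k = 1 then w else z, fun _ => by simpa using hu⟩
    · exact ⟨0, fun h => absurd h hp⟩
  choose g hg using haux
  -- Column `3p + k` holds the `k`-th witness for `p`; as `p ≥ 1`, columns 0 and 1 remain free for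
  -- the coordinates and for the inverse of the denominator.
  let x : ℕ → ℚ := fun n =>
    if n.unpair.2 = 0 then b n.unpair.1 else
    if n.unpair.2 = 1 then ((v.getD 0 0 : ℤ) : ℚ)⁻¹ else
      g n.unpair.1 (n.unpair.2 / 3) (n.unpair.2 % 3)
  have hx0 : ∀ i, x (Nat.pair i 0) = b i := fun i => by simp [x]
  have hx1 : x (Nat.pair 0 1) = ((v.getD 0 0 : ℤ) : ℚ)⁻¹ := by simp [x]
  have hx2 : ∀ i p k, 1 ≤ p → k < 3 → x (Nat.pair i (3 * p + k)) = g i p k := by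
    intro i p k hp hk
    simp only [x, Nat.unpair_pair]
    rw [if_neg (by omega), if_neg (by omega)]
    congr 1 <;> omega
  have hvq : ((v.getD 0 0 : ℤ) : ℚ) ≠ 0 := by exact_mod_cast hv0
  refine ⟨x, ?_⟩
  simp only [localSystem, List.forall_mem_cons, Terms.eval_rename, Terms.eval_cons,
    Terms.eval_nil, List.map_cons, List.map_nil, List.prod_cons, List.prod_nil, hx0, hx1]
  refine ⟨?_, ?_, ?_, ?_⟩
  · simp only [hb, List.getD_cons_succ]
    have := Terms.map_eval (fun i => v.getD i 0) (Int.castRingHom ℚ) (Terms.homogenize L)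
    rw [hev, map_zero] at this
    exact this.symm
  · simp only [hb, List.getD_cons_succ]
    field_simp
    norm_num
  · simp only [hb, List.getD_cons_succ, List.getD_cons_zero]
    have := congrArg (Int.cast : ℤ → ℚ) hcd
    push_cast at this ⊢
    linear_combination this
  · intro M hM
    obtain ⟨i, -, hM⟩ := List.mem_flatMap.1 hM
    obtain ⟨a, ha, rfl⟩ := List.mem_map.1 hM
    obtain ⟨hp1, hp2, hq, hq1, hq4, hqs⟩ := hA a ha
    rw [eval_quadTerms_eq_zero_iff hp1.one_le, hx0, hx2 _ _ 1 hp1.one_le (by norm_num),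
      hx2 _ _ 2 hp1.one_le (by norm_num), ← add_zero (3 * a.1),
      hx2 _ _ 0 hp1.one_le (by norm_num), hq]
    exact hg i a.1 (List.mem_map_of_mem ha)

/-- A polynomial with a rational zero if and only if `L` has a zero that is integral at the primes
listed in `A`. -/
def localTerms (L : Terms) (A : List (ℕ × ℕ)) : Terms := Terms.sumSq (localSystem L A)

theorem exists_eval_localTerms_iff {f : ℕ → ℕ} {L : Terms} {A : List (ℕ × ℕ)}
    (hA : Admissible f A) :
    (∃ x : ℕ → ℚ, Terms.eval x (localTerms L A) = 0) ↔
      SolvableWith (fun p => p ∉ A.map Prod.fst) L := by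
  simp only [localTerms, Terms.eval_sumSq_eq_zero_iff]
  exact ⟨fun ⟨_, hx⟩ => solvableWith_of_eval_localSystem hA hx, exists_eval_localSystem hA⟩

theorem primrec_quadTerms {α : Type*} [Primcodable α] {p q x u v z : α → ℕ} (hp : Primrec p)
    (hq : Primrec q) (hx : Primrec x) (hu : Primrec u) (hv : Primrec v) (hz : Primrec z) :
    Primrec fun a => quadTerms (p a) (q a) (x a) (u a) (v a) (z a) := by
  have neg : ∀ {g : α → ℕ}, Primrec g → Primrec fun a => -(g a : ℤ) := fun hg =>
    (primrec_int_mul.comp (.const (-1)) (primrec_int_natCast.comp hg)).of_eq fun _ => by simp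
  have two : ∀ {g : α → ℕ}, Primrec g → Primrec fun a => [g a, g a] := fun hg =>
    Primrec.list_cons.comp hg (Primrec.list_cons.comp hg (.const []))
  refine Primrec.list_cons.comp ((Primrec.const 1).pair (two hu)) ?_
  refine Primrec.list_cons.comp ((neg hq).pair (two hv)) ?_
  refine Primrec.list_cons.comp ((neg hp).pair (two hz)) ?_
  refine Primrec.list_cons.comp (.const _) ?_
  refine Primrec.list_cons.comp ((neg ?_).pair (two hx)) (.const _)
  exact Primrec.nat_mul.comp (Primrec.nat_mul.comp (Primrec.nat_mul.comp (.const 4) hp) hq)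
    (Primrec.nat_sub.comp hp (.const 1))

theorem primrec_localTerms : Primrec₂ localTerms := by
  refine Terms.primrec_sumSq.comp ?_
  have hL : Primrec fun a : Terms × List (ℕ × ℕ) => Terms.homogenize a.1 :=
    Terms.primrec_homogenize.comp .fst
  refine Primrec.list_cons.comp ?_ (Primrec.list_cons.comp (.const _)
    (Primrec.list_cons.comp ?_ ?_))
  · exact Terms.primrec_rename (Primrec₂.natPair.comp
      (Primrec.nat_add.comp .snd (.const 2)) (.const 0)).to₂ hL
  · refine Primrec.list_cons.comp (.const _) (Primrec.list_cons.comp (.const _)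
      (Primrec.list_cons.comp (Primrec.pair ?_ (.const _)) (.const _)))
    have : Primrec fun a : Terms × List (ℕ × ℕ) => (a.2.map Prod.fst).foldr (· * ·) 1 :=
      Primrec.list_foldr (Primrec.list_map .snd (Primrec.fst.comp .snd).to₂) (.const 1)
        (Primrec.nat_mul.comp (Primrec.fst.comp .snd) (Primrec.snd.comp .snd)).to₂
    exact (primrec_int_mul.comp (.const (-1)) (primrec_int_natCast.comp this)).of_eq
      fun _ => by simp
  · refine Primrec.list_flatMap (Primrec.list_range.comp (Primrec.nat_add.comp
      (Terms.primrec_varBound.comp hL) (.const 2))) ?_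
    refine Primrec.list_map (Primrec.snd.comp .fst) ?_
    have hi : Primrec fun b : ((Terms × List (ℕ × ℕ)) × ℕ) × (ℕ × ℕ) => b.1.2 :=
      Primrec.snd.comp .fst
    have hp : Primrec fun b : ((Terms × List (ℕ × ℕ)) × ℕ) × (ℕ × ℕ) => b.2.1 :=
      Primrec.fst.comp .snd
    have hp3 : Primrec fun b : ((Terms × List (ℕ × ℕ)) × ℕ) × (ℕ × ℕ) => 3 * b.2.1 :=
      Primrec.nat_mul.comp (.const 3) hp
    exact primrec_quadTerms hp (Primrec.snd.comp .snd) (Primrec₂.natPair.comp hi (.const 0))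
      (Primrec₂.natPair.comp hi hp3)
      (Primrec₂.natPair.comp hi (Primrec.nat_add.comp hp3 (.const 1)))
      (Primrec₂.natPair.comp hi (Primrec.nat_add.comp hp3 (.const 2)))

/-! ### Computable search -/

theorem computable_find {P : ℕ → ℕ → Prop} [∀ n, DecidablePred (P n)] (hP : PrimrecRel P)
    (h : ∀ n, ∃ m, P n m) : Computable fun n => Nat.find (h n) := by
  have h1 : Partrec₂ fun n m : ℕ => (Part.some (decide (P n m)) : Part Bool) :=
    (PrimrecPred.decide hP).to_comp.partrec
  refine (Partrec.rfind h1).of_eq_tot fun n => ?_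
  refine Nat.mem_rfind.2 ⟨?_, fun {m} hm => ?_⟩
  · simpa using Nat.find_spec (h n)
  · simpa using Nat.find_min (h n) hm

theorem computable_list_map_range {α : Type*} [Primcodable α] {f : ℕ → α} (hf : Computable f) :
    Computable fun n => (List.range n).map f := by
  have : Computable fun n : ℕ => (n.rec [] fun m l => l ++ [f m] : List α) := by
    refine Computable.nat_rec (f := id) (g := fun _ => ([] : List α))
      (h := fun _ p => p.2 ++ [f p.1]) .id (.const _) ?_
    exact (Computable.list_concat.comp (Computable.snd.comp .snd)
      (hf.comp (Computable.fst.comp .snd))).to₂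
  refine this.of_eq fun n => ?_
  induction n with
  | zero => rfl
  | succ n ih => simp only [List.range_succ, List.map_append, List.map_cons, List.map_nil, ← ih]

/-- The property of the auxiliary prime `q` of an odd prime `p`. -/
def IsAuxPrime (p q : ℕ) : Prop :=
  ¬ (p.Prime ∧ p ≠ 2) ∨ (q.Prime ∧ q % 4 = 1 ∧ ∀ x < p, x * x % p ≠ q % p)

theorem primrecRel_isAuxPrime : PrimrecRel IsAuxPrime := by
  refine PrimrecPred.or (((primrecPred_prime.comp .fst).and
    (Primrec.eq.comp .fst (.const 2)).not).not) ((primrecPred_prime.comp .snd).and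
    ((Primrec.eq.comp (Primrec.nat_mod.comp .snd (.const 4)) (.const 1)).and ?_))
  refine PrimrecRel.forall_lt_comp (R := fun x a => x * x % a.1 ≠ a.2 % a.1) ?_ .fst
  refine PrimrecPred.not (Primrec.eq.comp ?_ ?_)
  · exact Primrec.nat_mod.comp (Primrec.nat_mul.comp .fst .fst) (Primrec.fst.comp .snd)
  · exact Primrec.nat_mod.comp (Primrec.snd.comp .snd) (Primrec.fst.comp .snd)

theorem isSquare_natCast_zmod_iff {p q : ℕ} [NeZero p] :
    IsSquare (q : ZMod p) ↔ ∃ x < p, x * x % p = q % p := by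
  constructor
  · rintro ⟨r, hr⟩
    refine ⟨r.val, r.val_lt, ?_⟩
    refine (ZMod.natCast_eq_natCast_iff' _ _ _).1 ?_
    push_cast
    rw [ZMod.natCast_zmod_val, hr]
  · rintro ⟨x, -, hx⟩
    refine ⟨x, ?_⟩
    rw [← (ZMod.natCast_eq_natCast_iff' _ _ _).2 hx]
    push_cast
    rfl

theorem exists_isAuxPrime (p : ℕ) : ∃ q, IsAuxPrime p q := by
  by_cases hp : p.Prime ∧ p ≠ 2
  · obtain ⟨q, hq, hq4, hs⟩ := exists_prime_not_isSquare hp.1 hp.2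
    have : NeZero p := ⟨hp.1.ne_zero⟩
    rw [isSquare_natCast_zmod_iff] at hs
    push Not at hs
    exact ⟨q, Or.inr ⟨hq, hq4, hs⟩⟩
  · exact ⟨0, Or.inl hp⟩

open Classical in
/-- The least auxiliary prime of an odd prime `p`. -/
noncomputable def auxPrime (p : ℕ) : ℕ := Nat.find (exists_isAuxPrime p)

theorem computable_auxPrime : Computable auxPrime := by
  classical exact computable_find primrecRel_isAuxPrime exists_isAuxPrime

theorem auxPrime_spec {p : ℕ} (hp : p.Prime) (hp2 : p ≠ 2) :
    (auxPrime p).Prime ∧ auxPrime p % 4 = 1 ∧ ¬ IsSquare (auxPrime p : ZMod p) := by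
  classical
  have : NeZero p := ⟨hp.ne_zero⟩
  obtain h | ⟨h1, h2, h3⟩ := Nat.find_spec (exists_isAuxPrime p)
  · exact absurd ⟨hp, hp2⟩ h
  · refine ⟨h1, h2, ?_⟩
    rw [isSquare_natCast_zmod_iff]
    push Not
    exact h3

theorem admissible_of_forall {A : List (ℕ × ℕ)}
    (h : ∀ a ∈ A, a.1.Prime ∧ a.1 ≠ 2 ∧ a.2 = auxPrime a.1) : Admissible auxPrime A :=
  fun a ha => ⟨(h a ha).1, (h a ha).2.1, (h a ha).2.2, auxPrime_spec (h a ha).1 (h a ha).2.1⟩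

/-! ### A computable set of primes with prescribed density -/

/-- One step of the greedy construction: the state consists of the number of chosen primes, the
number of primes, and the list of the chosen primes among the numbers seen so far. -/
def greedyStep (a : ℤ) (b n : ℕ) (s : ℕ × ℕ × List ℕ) : ℕ × ℕ × List ℕ :=
  if n.Prime then
    if n = 2 ∨ (s.1 : ℤ) * b < a * s.2.1 then (s.1 + 1, s.2.1 + 1, s.2.2 ++ [n])
    else (s.1, s.2.1 + 1, s.2.2)
  else s

/-- The states of the greedy construction. -/
def greedyState (a : ℕ → ℤ) (b : ℕ → ℕ) (n : ℕ) : ℕ × ℕ × List ℕ :=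
  n.rec (0, 0, []) fun m s => greedyStep (a m) (b m) m s

/-- The primes below `n` chosen by the greedy construction. -/
def greedyList (a : ℕ → ℤ) (b : ℕ → ℕ) (n : ℕ) : List ℕ := (greedyState a b n).2.2

/-- The set of primes chosen by the greedy construction. -/
def greedySet (a : ℕ → ℤ) (b : ℕ → ℕ) : Set ℕ := {n | n ∈ greedyList a b (n + 1)}

theorem primrecRel_int_lt : PrimrecRel ((· < ·) : ℤ → ℤ → Prop) := by
  have : PrimrecRel fun a b : ℤ => 0 < (b + (-1) * a).toNat :=
    Primrec.nat_lt.comp (.const 0) (primrec_int_toNat.comp (primrec_int_add.comp .snd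
      (primrec_int_mul.comp (.const (-1)) .fst)))
  refine PrimrecPred.of_eq this fun p => ?_
  omega

theorem primrec_greedyStep :
    Primrec fun x : ℤ × ℕ × ℕ × (ℕ × ℕ × List ℕ) => greedyStep x.1 x.2.1 x.2.2.1 x.2.2.2 := by
  have hb : Primrec fun x : ℤ × ℕ × ℕ × (ℕ × ℕ × List ℕ) => x.2.1 := Primrec.fst.comp .snd
  have hn : Primrec fun x : ℤ × ℕ × ℕ × (ℕ × ℕ × List ℕ) => x.2.2.1 :=
    Primrec.fst.comp (Primrec.snd.comp .snd)
  have hs : Primrec fun x : ℤ × ℕ × ℕ × (ℕ × ℕ × List ℕ) => x.2.2.2 :=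
    Primrec.snd.comp (Primrec.snd.comp .snd)
  have h1 := Primrec.fst.comp hs
  have h2 := Primrec.fst.comp (Primrec.snd.comp hs)
  have h3 := Primrec.snd.comp (Primrec.snd.comp hs)
  refine Primrec.ite (primrecPred_prime.comp hn) (Primrec.ite ?_ ?_ ?_) hs
  · refine (Primrec.eq.comp hn (.const 2)).or (primrecRel_int_lt.comp ?_ ?_)
    · exact primrec_int_mul.comp (primrec_int_natCast.comp h1) (primrec_int_natCast.comp hb)
    · exact primrec_int_mul.comp .fst (primrec_int_natCast.comp h2)
  · exact (Primrec.succ.comp h1).pair ((Primrec.succ.comp h2).pair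
      (Primrec.list_concat.comp h3 hn))
  · exact h1.pair ((Primrec.succ.comp h2).pair h3)

section greedy

variable {a : ℕ → ℤ} {b : ℕ → ℕ}

theorem computable_greedyList (ha : Computable a) (hb : Computable b) :
    Computable (greedyList a b) := by
  refine Computable.snd.comp (Computable.snd.comp ?_)
  refine Computable.nat_rec (f := id) (g := fun _ => ((0, 0, []) : ℕ × ℕ × List ℕ))
    (h := fun _ p => greedyStep (a p.1) (b p.1) p.1 p.2) .id (.const _) ?_
  have hn : Computable fun p : ℕ × ℕ × (ℕ × ℕ × List ℕ) => p.2.1 := Computable.fst.comp .snd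
  exact (primrec_greedyStep.to_comp.comp ((ha.comp hn).pair ((hb.comp hn).pair
    (hn.pair (Computable.snd.comp .snd))))).to₂

theorem greedyState_succ (n : ℕ) :
    greedyState a b (n + 1) = greedyStep (a n) (b n) n (greedyState a b n) := rfl

theorem greedyList_succ (n : ℕ) : greedyList a b (n + 1) = greedyList a b n ∨
    greedyList a b (n + 1) = greedyList a b n ++ [n] := by
  simp only [greedyList, greedyState_succ, greedyStep]
  split_ifs <;> simp

theorem mem_greedyList_iff {n m : ℕ} :
    m ∈ greedyList a b n ↔ m < n ∧ m ∈ greedySet a b := by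
  have hlt : ∀ n m, m ∈ greedyList a b n → m < n := by
    intro n
    induction n with
    | zero => intro m h; simp [greedyList, greedyState] at h
    | succ n ih =>
      intro m h
      rcases greedyList_succ (a := a) (b := b) n with h' | h' <;> rw [h'] at h
      · exact (ih m h).trans (Nat.lt_succ_self n)
      · rcases List.mem_append.1 h with h | h
        · exact (ih m h).trans (Nat.lt_succ_self n)
        · simp at h; omega
  have hsucc : ∀ n m, m < n → (m ∈ greedyList a b (n + 1) ↔ m ∈ greedyList a b n) := by
    intro n m hm
    rcases greedyList_succ (a := a) (b := b) n with h' | h' <;> rw [h']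
    simp [hm.ne]
  constructor
  · intro h
    refine ⟨hlt n m h, ?_⟩
    induction n with
    | zero => exact absurd (hlt 0 m h) (by omega)
    | succ n ih =>
      have := hlt _ m h
      rcases Nat.lt_succ_iff_lt_or_eq.1 this with h1 | rfl
      · exact ih ((hsucc n m h1).1 h)
      · exact h
  · rintro ⟨h, hm⟩
    induction n with
    | zero => omega
    | succ n ih =>
      rcases Nat.lt_succ_iff_lt_or_eq.1 h with h1 | rfl
      · exact (hsucc n m h1).2 (ih h1)
      · exact hm

theorem greedySet_iff (n : ℕ) : n ∈ greedySet a b ↔ n.Prime ∧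
    (n = 2 ∨ ((greedyState a b n).1 : ℤ) * b n < a n * (greedyState a b n).2.1) := by
  have h : n ∉ greedyList a b n := fun h => (mem_greedyList_iff.1 h).1.false
  unfold greedyList at h
  simp only [greedySet, Set.mem_ofPred_eq, greedyList, greedyState_succ, greedyStep]
  split_ifs with h1 h2
  · simp [h1, h2]
  · simp [h1, h2, h]
  · simp [h1, h]

theorem prime_of_mem_greedySet {n : ℕ} (h : n ∈ greedySet a b) : n.Prime :=
  ((greedySet_iff n).1 h).1

theorem two_mem_greedySet : 2 ∈ greedySet a b := (greedySet_iff 2).2 ⟨Nat.prime_two, Or.inl rfl⟩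

open Classical in
theorem greedyState_eq_count (n : ℕ) : (greedyState a b n).1 = Nat.count (· ∈ greedySet a b) n ∧
    (greedyState a b n).2.1 = Nat.count Nat.Prime n := by
  induction n with
  | zero => simp [greedyState]
  | succ n ih =>
    rw [Nat.count_succ, Nat.count_succ, ← ih.1, ← ih.2, greedyState_succ, greedyStep]
    have h := greedySet_iff (a := a) (b := b) n
    by_cases h1 : n.Prime
    · by_cases h2 : n = 2 ∨ ((greedyState a b n).1 : ℤ) * b n < a n * (greedyState a b n).2.1
      · rw [if_pos h1, if_pos h2, if_pos (h.2 ⟨h1, h2⟩), if_pos h1]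
        exact ⟨rfl, rfl⟩
      · rw [if_pos h1, if_neg h2, if_neg fun h3 => h2 (h.1 h3).2, if_pos h1]
        exact ⟨rfl, rfl⟩
    · rw [if_neg h1, if_neg fun h3 => h1 (h.1 h3).1, if_neg h1]
      exact ⟨rfl, rfl⟩

open Classical in
theorem mem_greedySet_iff_count (n : ℕ) (hb : 0 < b n) (hn : n.Prime) (hn2 : n ≠ 2) :
    n ∈ greedySet a b ↔ (Nat.count (· ∈ greedySet a b) n : ℝ) <
      (a n : ℝ) / b n * Nat.count Nat.Prime n := by
  rw [greedySet_iff, (greedyState_eq_count n).1, (greedyState_eq_count n).2]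
  have hb' : (0 : ℝ) < b n := by exact_mod_cast hb
  rw [div_mul_eq_mul_div, lt_div_iff₀ hb']
  simp only [hn, hn2, true_and, false_or]
  exact_mod_cast Iff.rfl

-- Beyond `n₀` a prime is added only while the count is below `(r + ε)` times the number of primes,
-- so one addition overshoots by at most 1.
open Classical in
theorem exists_count_greedySet_le {r : ℝ} (hr0 : 0 ≤ r) (hb : ∀ n, 0 < b n)
    (h : Tendsto (fun n => (a n : ℝ) / (b n : ℝ)) atTop (𝓝 r)) {ε : ℝ} (hε : 0 < ε) :
    ∃ C : ℝ, ∀ n, (Nat.count (· ∈ greedySet a b) n : ℝ) ≤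
      (r + ε) * Nat.count Nat.Prime n + C := by
  -- Requiring `n ≥ 3` excludes the prime 2, which is chosen regardless of the approximation.
  obtain ⟨n₀, hn₀⟩ := eventually_atTop.1
    ((h.eventually (gt_mem_nhds (show r < r + ε by linarith))).and (eventually_ge_atTop 3))
  refine ⟨n₀ + 1, fun n => ?_⟩
  have hmono : (0 : ℝ) ≤ r + ε := by linarith
  have h0 : ∀ n, (0 : ℝ) ≤ (r + ε) * Nat.count Nat.Prime n := fun n => by positivity
  induction n with
  | zero => simp; positivity
  | succ n ih =>
    have hmul : (r + ε) * (Nat.count Nat.Prime n : ℝ) ≤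
        (r + ε) * (Nat.count Nat.Prime (n + 1) : ℝ) := by
      apply mul_le_mul_of_nonneg_left _ hmono
      exact_mod_cast Nat.count_monotone _ (Nat.le_succ n)
    by_cases hn : n < n₀
    · have : Nat.count (· ∈ greedySet a b) (n + 1) ≤ n + 1 := Nat.count_le _
      have h2 : (Nat.count (· ∈ greedySet a b) (n + 1) : ℝ) ≤ n₀ := by exact_mod_cast (by omega)
      linarith [h0 (n + 1)]
    · obtain ⟨h1, h3⟩ := hn₀ n (by omega)
      rw [Nat.count_succ]
      split_ifs with hm
      · have hp := prime_of_mem_greedySet hm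
        rw [mem_greedySet_iff_count n (hb n) hp (by omega)] at hm
        have : (a n : ℝ) / b n * Nat.count Nat.Prime n ≤ (r + ε) * Nat.count Nat.Prime n :=
          mul_le_mul_of_nonneg_right h1.le (Nat.cast_nonneg _)
        push_cast
        have : (0 : ℝ) ≤ n₀ := Nat.cast_nonneg _
        linarith
      · push_cast
        linarith

-- When a prime is refused, the count is at least `(r - ε)` times the number of earlier primes, and
-- the refusal costs at most `r - ε ≤ 1`. When a prime is added, the count grows by at least as much
-- as the left side.
open Classical in
theorem exists_le_count_greedySet {r : ℝ} (hr1 : r ≤ 1) (hb : ∀ n, 0 < b n)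
    (h : Tendsto (fun n => (a n : ℝ) / (b n : ℝ)) atTop (𝓝 r)) {ε : ℝ} (hε : 0 < ε) :
    ∃ C : ℝ, ∀ n, (r - ε) * Nat.count Nat.Prime n ≤
      (Nat.count (· ∈ greedySet a b) n : ℝ) + C := by
  obtain ⟨n₀, hn₀⟩ := eventually_atTop.1
    ((h.eventually (lt_mem_nhds (show r - ε < r by linarith))).and (eventually_ge_atTop 3))
  refine ⟨n₀ + 1, fun n => ?_⟩
  have hpos : (0 : ℝ) ≤ n₀ := Nat.cast_nonneg _
  induction n with
  | zero => simp; positivity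
  | succ n ih =>
    by_cases hn : n < n₀
    · have h1 : (Nat.count Nat.Prime (n + 1) : ℝ) ≤ n₀ := by
        have : Nat.count Nat.Prime (n + 1) ≤ n + 1 := Nat.count_le _
        exact_mod_cast (by omega)
      have h2 : (r - ε) * Nat.count Nat.Prime (n + 1) ≤ 1 * Nat.count Nat.Prime (n + 1) :=
        mul_le_mul_of_nonneg_right (by linarith) (Nat.cast_nonneg _)
      have h3 : (0 : ℝ) ≤ Nat.count (· ∈ greedySet a b) (n + 1) := Nat.cast_nonneg _
      linarith
    · obtain ⟨h1, h3⟩ := hn₀ n (by omega)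
      rw [Nat.count_succ, Nat.count_succ]
      by_cases hp : n.Prime
      · have hm := mem_greedySet_iff_count (a := a) n (hb n) hp (by omega)
        split_ifs with hm'
        · push_cast
          linarith
        · have hm'' := not_lt.1 (fun h => hm' (hm.2 h))
          have : (r - ε) * Nat.count Nat.Prime n ≤ (a n : ℝ) / b n * Nat.count Nat.Prime n :=
            mul_le_mul_of_nonneg_right h1.le (Nat.cast_nonneg _)
          push_cast
          linarith
      · have hm : n ∉ greedySet a b := fun h => hp (prime_of_mem_greedySet h)
        simp only [hp, hm, if_false, add_zero]
        exact ih

end greedy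

/-! ### Lower density -/

theorem ncard_eq_count (P : ℕ → Prop) [DecidablePred P] (N : ℕ) :
    {p : ℕ | P p ∧ p ≤ N}.ncard = Nat.count P (N + 1) := by
  rw [Nat.count_eq_card_filter_range, ← Set.ncard_coe_finset]
  congr 1
  ext p
  simp only [Set.mem_ofPred_eq, Finset.coe_filter, Finset.mem_range]
  constructor
  · rintro ⟨h1, h2⟩; exact ⟨by omega, h1⟩
  · rintro ⟨h1, h2⟩; exact ⟨h2, by omega⟩

theorem tendsto_count_prime : Tendsto (fun N => (Nat.count Nat.Prime (N + 1) : ℝ)) atTop atTop := by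
  have := Nat.tendsto_primeCounting
  exact tendsto_natCast_atTop_atTop.comp this

-- The lower bound is inherited from `B ⊆ S`. For the upper bound it suffices that the excess of `S`
-- over `B` is negligible along some sequence of `N`.
open Classical in
theorem lowerPrimeDensity_eq {S B : Set ℕ} {r : ℝ} (hBS : B ⊆ S) (hB : ∀ p ∈ B, p.Prime)
    (hupper : ∀ ε > 0, ∃ C : ℝ, ∀ n, (Nat.count (· ∈ B) n : ℝ) ≤
      (r + ε) * Nat.count Nat.Prime n + C)
    (hlower : ∀ ε > 0, ∃ C : ℝ, ∀ n, (r - ε) * Nat.count Nat.Prime n ≤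
      (Nat.count (· ∈ B) n : ℝ) + C)
    (hfreq : ∀ k : ℕ, ∃ N ≥ k, (k + 1) * Nat.count (fun p => p.Prime ∧ p ∈ S) (N + 1) ≤
      (k + 1) * Nat.count (· ∈ B) (N + 1) + Nat.count Nat.Prime (N + 1)) :
    lowerPrimeDensity S = r := by
  unfold lowerPrimeDensity
  have hfun : (fun N : ℕ => ({p : ℕ | p.Prime ∧ p ∈ S ∧ p ≤ N}.ncard : ℝ) /
      ({p : ℕ | p.Prime ∧ p ≤ N}.ncard : ℝ)) = fun N =>
      (Nat.count (fun p => p.Prime ∧ p ∈ S) (N + 1) : ℝ) / Nat.count Nat.Prime (N + 1) := by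
    funext N
    have : {p : ℕ | p.Prime ∧ p ∈ S ∧ p ≤ N} = {p : ℕ | (p.Prime ∧ p ∈ S) ∧ p ≤ N} := by
      ext p; simp only [Set.mem_ofPred_eq, and_assoc]
    rw [this, ncard_eq_count Nat.Prime, ncard_eq_count fun p => p.Prime ∧ p ∈ S]
  rw [hfun]
  have hle : ∀ N, (Nat.count (fun p => p.Prime ∧ p ∈ S) (N + 1) : ℝ) ≤
      Nat.count Nat.Prime (N + 1) := fun N => by
    have : Nat.count (fun p => p.Prime ∧ p ∈ S) (N + 1) ≤ Nat.count Nat.Prime (N + 1) :=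
      Nat.count_mono_left fun p _ hp => hp.1
    exact_mod_cast this
  have hbd1 : IsBoundedUnder (· ≥ ·) atTop fun N =>
      (Nat.count (fun p => p.Prime ∧ p ∈ S) (N + 1) : ℝ) / Nat.count Nat.Prime (N + 1) :=
    isBoundedUnder_of ⟨0, fun N => by positivity⟩
  have hbd2 : IsCoboundedUnder (· ≥ ·) atTop fun N =>
      (Nat.count (fun p => p.Prime ∧ p ∈ S) (N + 1) : ℝ) / Nat.count Nat.Prime (N + 1) :=
    (isBoundedUnder_of ⟨1, fun N => div_le_one_of_le₀ (hle N) (Nat.cast_nonneg _)⟩ :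
      IsBoundedUnder (· ≤ ·) atTop _).isCoboundedUnder_ge
  apply le_antisymm
  · refine le_of_forall_pos_le_add fun ε hε => ?_
    refine liminf_le_of_frequently_le ?_ hbd1
    rw [frequently_atTop]
    intro k₀
    -- One third of `ε` each for the density of `B`, the constant `C` and the excess `1 / (k + 1)`.
    obtain ⟨C, hC⟩ := hupper (ε / 3) (by positivity)
    obtain ⟨k₁, hk₁⟩ := eventually_atTop.1
      (tendsto_count_prime.eventually (eventually_ge_atTop (max 1 (C / (ε / 3)))))
    obtain ⟨k₂, hk₂⟩ := exists_nat_gt (1 / (ε / 3))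
    obtain ⟨N, hN, hcount⟩ := hfreq (max k₀ (max k₁ k₂))
    set k := max k₀ (max k₁ k₂)
    refine ⟨N, (le_max_left _ _).trans hN, ?_⟩
    have hkN := hk₁ N (((le_max_left _ _).trans (le_max_right _ _)).trans hN)
    have hpos : (0 : ℝ) < Nat.count Nat.Prime (N + 1) :=
      zero_lt_one.trans_le ((le_max_left _ _).trans hkN)
    have hCN : C ≤ ε / 3 * Nat.count Nat.Prime (N + 1) := by
      have := (le_max_right _ _).trans hkN
      rwa [div_le_iff₀ (by positivity), mul_comm] at this
    rw [div_le_iff₀ hpos]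
    have hk2 : (k₂ : ℝ) ≤ k := by
      exact_mod_cast (le_max_right _ _).trans (le_max_right _ _)
    have hk : 1 < ε / 3 * (k + 1) := by
      rw [div_lt_iff₀ (by positivity)] at hk₂
      nlinarith
    have hcount' : ((k : ℝ) + 1) * Nat.count (fun p => p.Prime ∧ p ∈ S) (N + 1) ≤
        (k + 1) * Nat.count (· ∈ B) (N + 1) + Nat.count Nat.Prime (N + 1) := by
      exact_mod_cast hcount
    have hk0 : (0 : ℝ) < k + 1 := by positivity
    refine le_of_mul_le_mul_left (hcount'.trans ?_) hk0
    have h1 := mul_le_mul_of_nonneg_left (hC (N + 1)) hk0.le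
    have h2 := mul_le_mul_of_nonneg_left hCN hk0.le
    have h3 := mul_le_mul_of_nonneg_right hk.le hpos.le
    linarith
  · refine le_of_forall_pos_le_add fun ε hε => ?_
    rw [← sub_le_iff_le_add]
    refine le_liminf_of_le hbd2 ?_
    obtain ⟨C, hC⟩ := hlower (ε / 2) (by positivity)
    filter_upwards [tendsto_count_prime.eventually (eventually_ge_atTop (max 1 (C / (ε / 2))))]
      with N hN
    have hpos : (0 : ℝ) < Nat.count Nat.Prime (N + 1) :=
      zero_lt_one.trans_le ((le_max_left _ _).trans hN)
    have hCN : C ≤ ε / 2 * Nat.count Nat.Prime (N + 1) := by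
      have := (le_max_right _ _).trans hN
      rwa [div_le_iff₀ (by positivity), mul_comm] at this
    rw [le_div_iff₀ hpos]
    have h1 := hC (N + 1)
    have h2 : (Nat.count (· ∈ B) (N + 1) : ℝ) ≤
        Nat.count (fun p => p.Prime ∧ p ∈ S) (N + 1) := by
      have : Nat.count (· ∈ B) (N + 1) ≤ Nat.count (fun p => p.Prime ∧ p ∈ S) (N + 1) :=
        Nat.count_mono_left fun p _ hp => ⟨hB p hp, hBS hp⟩
      exact_mod_cast this
    linarith

/-! ### The finite injury construction

A history is a list of pairs `(e, w)`, the latest first: the requirement `e` was satisfied by a zero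
of the `e`-th polynomial with common denominator `w`. -/

/-- The product of all denominators of a history. -/
def denomProd (H : List (ℕ × ℕ)) : ℕ := H.foldr (fun h d => h.2 * d) 1

/-- The bound below which the requirement `e` must not add primes. -/
def restraint (e : ℕ) : List (ℕ × ℕ) → ℕ
  | [] => 2 ^ (e + 1)
  | h :: H => if h.1 < e then 2 ^ ((e + 1) * denomProd (h :: H)) else restraint e H

/-- The primes that the requirement `e` may invert, where `b` tells membership in the base set. -/
def Allowed (b : ℕ → Prop) (H : List (ℕ × ℕ)) (e p : ℕ) : Prop :=
  b p ∨ p ∣ denomProd H ∨ restraint e H < p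

/-- The first coordinate of the vector with code `c`, up to sign. -/
def codeDenom (c : ℕ) : ℕ := ((Denumerable.ofNat (List ℤ) c).getD 0 0).natAbs

/-- The vector with code `c` may be used to satisfy the requirement `e`. -/
def CanAct (l : List ℕ) (s : ℕ) (H : List (ℕ × ℕ)) (e c : ℕ) : Prop :=
  e ∉ H.map Prod.fst ∧ codeDenom c ≠ 0 ∧ codeDenom c ≤ s ∧
    (∀ p < s + 1, ¬ (p.Prime ∧ p ∣ codeDenom c) ∨ Allowed (· ∈ l) H e p) ∧
    Terms.eval (fun i => (Denumerable.ofNat (List ℤ) c).getD i 0)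
      (Terms.homogenize (Denumerable.ofNat Terms e)) = 0

open Classical in
/-- The possible actions at stage `s`, ordered by priority. -/
noncomputable def actions (l : List ℕ) (s : ℕ) (H : List (ℕ × ℕ)) : List (ℕ × ℕ) :=
  (List.range s).flatMap fun e =>
    ((List.range s).filter fun c => CanAct l s H e c).map fun c => (e, codeDenom c)

/-- The history before stage `s`. -/
noncomputable def history (l : ℕ → List ℕ) (s : ℕ) : List (ℕ × ℕ) :=
  s.rec [] fun s H => (actions (l (s + 1)) s H).take 1 ++ H

/-- The set of primes that is constructed from the base set `B`. -/
def injurySet (B : Set ℕ) (l : ℕ → List ℕ) : Set ℕ :=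
  {p | p ∈ B ∨ p.Prime ∧ ∃ s, p ∣ denomProd (history l s)}

/-! #### Primitive recursiveness -/

theorem primrec_denomProd : Primrec denomProd :=
  Primrec.list_foldr .id (.const 1)
    (Primrec.nat_mul.comp (Primrec.snd.comp (Primrec.fst.comp .snd)) (Primrec.snd.comp .snd)).to₂

theorem primrec_restraint : Primrec₂ restraint := by
  have : Primrec fun x : ℕ × List (ℕ × ℕ) => (List.rec (2 ^ (x.1 + 1)) (fun h H ih =>
      if h.1 < x.1 then 2 ^ ((x.1 + 1) * denomProd (h :: H)) else ih) x.2 : ℕ) := by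
    refine Primrec.list_rec (f := fun x : ℕ × List (ℕ × ℕ) => x.2)
      (g := fun x => 2 ^ (x.1 + 1))
      (h := fun x y => if y.1.1 < x.1 then 2 ^ ((x.1 + 1) * denomProd (y.1 :: y.2.1)) else y.2.2)
      .snd (primrec_nat_pow.comp (.const 2) (Primrec.succ.comp .fst)) ?_
    refine Primrec.ite (Primrec.nat_lt.comp (Primrec.fst.comp (Primrec.fst.comp .snd))
      (Primrec.fst.comp .fst)) (primrec_nat_pow.comp (.const 2) (Primrec.nat_mul.comp
        (Primrec.succ.comp (Primrec.fst.comp .fst)) (primrec_denomProd.comp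
          (Primrec.list_cons.comp (Primrec.fst.comp .snd)
            (Primrec.fst.comp (Primrec.snd.comp .snd))))))
      (Primrec.snd.comp (Primrec.snd.comp .snd))
  refine this.of_eq fun x => ?_
  obtain ⟨e, H⟩ := x
  induction H with
  | nil => rfl
  | cons h H ih => simp only [restraint, ← ih]

theorem primrecRel_mem_list {α : Type*} [Primcodable α] :
    PrimrecRel fun (a : α) (l : List α) => a ∈ l := by
  have : PrimrecRel fun (l : List α) (a : α) => ∃ b ∈ l, b = a :=
    PrimrecRel.exists_mem_list (Primrec.eq (α := α))
  refine PrimrecPred.of_eq (PrimrecRel.comp this .snd .fst) fun p => ?_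
  simp

theorem primrec_ofNat_list : Primrec (Denumerable.ofNat (List ℤ)) :=
  Primrec.option_some_iff.1 (Primrec.decode.of_eq fun n => Denumerable.decode_eq_ofNat _ n)

theorem primrec_codeDenom : Primrec codeDenom := by
  have h : Primrec Int.natAbs :=
    (Primrec.nat_add.comp primrec_int_toNat primrec_int_neg_toNat).of_eq fun z => by omega
  exact h.comp ((Primrec.list_getD 0).comp primrec_ofNat_list (.const 0))

theorem primrecPred_allowed {α : Type*} [Primcodable α] {l : α → List ℕ} {H : α → List (ℕ × ℕ)}
    {e p : α → ℕ} (hl : Primrec l) (hH : Primrec H) (he : Primrec e) (hp : Primrec p) :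
    PrimrecPred fun a => Allowed (· ∈ l a) (H a) (e a) (p a) :=
  (primrecRel_mem_list.comp hp hl).or ((primrecRel_dvd.comp hp (primrec_denomProd.comp hH)).or
    (Primrec.nat_lt.comp (primrec_restraint.comp he hH) hp))

theorem primrecPred_canAct {α : Type*} [Primcodable α] {l : α → List ℕ} {s : α → ℕ}
    {H : α → List (ℕ × ℕ)} {e c : α → ℕ} (hl : Primrec l) (hs : Primrec s) (hH : Primrec H)
    (he : Primrec e) (hc : Primrec c) :
    PrimrecPred fun a => CanAct (l a) (s a) (H a) (e a) (c a) := by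
  have hd := primrec_codeDenom.comp hc
  refine (primrecRel_mem_list.comp he (Primrec.list_map hH (Primrec.fst.comp .snd).to₂)).not.and
    ((Primrec.eq.comp hd (.const 0)).not.and ((Primrec.nat_le.comp hd hs).and (.and ?_ ?_)))
  · refine PrimrecRel.forall_lt_comp (R := fun p a => ¬ (p.Prime ∧ p ∣ codeDenom (c a)) ∨
      Allowed (· ∈ l a) (H a) (e a) p) ?_ (Primrec.succ.comp hs)
    exact ((primrecPred_prime.comp .fst).and (primrecRel_dvd.comp .fst (hd.comp .snd))).not.or
      (primrecPred_allowed (hl.comp .snd) (hH.comp .snd) (he.comp .snd) .fst)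
  · exact Primrec.eq.comp (Terms.primrec_eval_list.comp (primrec_ofNat_list.comp hc)
      (Terms.primrec_homogenize.comp (Terms.primrec_ofNat.comp he))) (.const 0)

theorem primrec_filter_range {α : Type*} [Primcodable α] {R : ℕ → α → Prop}
    [∀ a, DecidablePred (R · a)] {f : α → ℕ}
    (hR : PrimrecRel R) (hf : Primrec f) : Primrec fun a => (List.range (f a)).filter (R · a) := by
  classical
  refine ((PrimrecRel.listFilter hR).comp (Primrec.list_range.comp hf) .id).of_eq fun a => ?_
  congr!

theorem primrec_actions :
    Primrec fun x : List ℕ × ℕ × List (ℕ × ℕ) => actions x.1 x.2.1 x.2.2 := by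
  classical
  refine Primrec.list_flatMap (Primrec.list_range.comp (Primrec.fst.comp .snd)) ?_
  refine Primrec.list_map (primrec_filter_range
    (R := fun c x => CanAct x.1.1 x.1.2.1 x.1.2.2 x.2 c) ?_
    (Primrec.fst.comp (Primrec.snd.comp .fst))) ?_
  · have h : Primrec fun x : ℕ × ((List ℕ × ℕ × List (ℕ × ℕ)) × ℕ) => x.2.1 :=
      Primrec.fst.comp .snd
    exact primrecPred_canAct (Primrec.fst.comp h) (Primrec.fst.comp (Primrec.snd.comp h))
      (Primrec.snd.comp (Primrec.snd.comp h)) (Primrec.snd.comp .snd) .fst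
  · exact ((Primrec.snd.comp .fst).pair (primrec_codeDenom.comp .snd)).to₂

theorem computable_nat_rec_of_primrec {step : List ℕ × ℕ × List (ℕ × ℕ) → List (ℕ × ℕ)}
    (hstep : Primrec step) {l : ℕ → List ℕ} (hl : Computable l) :
    Computable fun s : ℕ => (s.rec [] fun s H => step (l (s + 1), s, H) : List (ℕ × ℕ)) := by
  have hs : Computable fun x : ℕ × (ℕ × List (ℕ × ℕ)) => x.2.1 := Computable.fst.comp .snd
  have hH : Computable fun x : ℕ × (ℕ × List (ℕ × ℕ)) => x.2.2 := Computable.snd.comp .snd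
  exact Computable.nat_rec (f := id) (g := fun _ => ([] : List (ℕ × ℕ)))
    (h := fun _ p => step (l (p.1 + 1), p.1, p.2)) .id (.const _)
    (hstep.to_comp.comp ((hl.comp (Computable.succ.comp hs)).pair (hs.pair hH))).to₂

theorem primrec_take_one_append {α β : Type*} [Primcodable α] [Primcodable β] {f g : α → List β}
    (hf : Primrec f) (hg : Primrec g) : Primrec fun a => (f a).take 1 ++ g a :=
  Primrec.list_append.comp (Primrec.list_take.comp (.const 1) hf) hg

theorem computable_history {l : ℕ → List ℕ} (hl : Computable l) : Computable (history l) :=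
  computable_nat_rec_of_primrec
    (primrec_take_one_append primrec_actions (Primrec.snd.comp .snd)) hl

/-! #### Basic properties of the construction -/

/-- The head of a concatenation comes from the first nonempty list; this is how the smallest index
gets priority. -/
theorem mem_take_one_flatMap_range {β : Type*} {f : ℕ → List β} {n : ℕ} {x : β}
    (h : x ∈ ((List.range n).flatMap f).take 1) :
    ∃ e < n, x ∈ f e ∧ ∀ e' < e, f e' = [] := by
  induction n with
  | zero => simp at h
  | succ n ih =>
    rw [List.range_succ, List.flatMap_append] at h
    by_cases h0 : (List.range n).flatMap f = []
    · rw [h0, List.nil_append] at h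
      have hx : x ∈ f n := by simpa using List.mem_of_mem_take h
      refine ⟨n, Nat.lt_succ_self n, hx, fun e' he' => ?_⟩
      exact List.flatMap_eq_nil_iff.1 h0 e' (List.mem_range.2 he')
    · rw [List.take_append_of_le_length (List.length_pos_iff.2 h0)] at h
      obtain ⟨e, he, h⟩ := ih h
      exact ⟨e, he.trans (Nat.lt_succ_self n), h⟩

theorem denomProd_append (H H' : List (ℕ × ℕ)) :
    denomProd (H ++ H') = denomProd H * denomProd H' := by
  induction H with
  | nil => simp [denomProd]
  | cons h H ih =>
    have : ∀ H, denomProd (h :: H) = h.2 * denomProd H := fun _ => rfl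
    rw [List.cons_append, this, this, ih, mul_assoc]

section history

variable {l : ℕ → List ℕ} {B : Set ℕ}

theorem history_succ (s : ℕ) :
    history l (s + 1) = (actions (l (s + 1)) s (history l s)).take 1 ++ history l s := rfl

theorem mem_actions {l : List ℕ} {s : ℕ} {H : List (ℕ × ℕ)} {x : ℕ × ℕ}
    (h : x ∈ (actions l s H).take 1) :
    ∃ c, CanAct l s H x.1 c ∧ x.2 = codeDenom c ∧ ∀ e < x.1, ∀ c < s, ¬ CanAct l s H e c := by
  obtain ⟨e, he, hx, hlt⟩ := mem_take_one_flatMap_range h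
  obtain ⟨c, hc, rfl⟩ := List.mem_map.1 hx
  rw [List.mem_filter] at hc
  refine ⟨c, by simpa using hc.2, rfl, fun e' he' c' hc' hact => ?_⟩
  have := hlt e' he'
  rw [List.map_eq_nil_iff, List.filter_eq_nil_iff] at this
  exact this c' (List.mem_range.2 hc') (by simpa using hact)

theorem history_succ_cases (s : ℕ) : history l (s + 1) = history l s ∨
    ∃ e c, history l (s + 1) = (e, codeDenom c) :: history l s ∧
      CanAct (l (s + 1)) s (history l s) e c := by
  rw [history_succ]
  rcases h : (actions (l (s + 1)) s (history l s)).take 1 with _ | ⟨x, L⟩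
  · exact Or.inl rfl
  · have hL : L = [] := by
      have := congrArg List.length h
      simp only [List.length_take, List.length_cons] at this
      exact List.length_eq_zero_iff.1 (by omega)
    obtain ⟨c, hc, hx, -⟩ := mem_actions (x := x) (by rw [h]; simp)
    refine Or.inr ⟨x.1, c, ?_, hc⟩
    rw [hL, ← hx]
    rfl

theorem history_suffix {s t : ℕ} (h : s ≤ t) : ∃ H, history l t = H ++ history l s := by
  induction t, h using Nat.le_induction with
  | base => exact ⟨[], rfl⟩
  | succ t _ ih =>
    obtain ⟨H, hH⟩ := ih
    exact ⟨_ ++ H, by rw [history_succ, hH, List.append_assoc]⟩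

theorem denomProd_history_dvd {s t : ℕ} (h : s ≤ t) :
    denomProd (history l s) ∣ denomProd (history l t) := by
  obtain ⟨H, hH⟩ := history_suffix (l := l) h
  rw [hH, denomProd_append]
  exact dvd_mul_left _ _

theorem history_mono {s t e : ℕ} (h : s ≤ t) (he : e ∈ (history l s).map Prod.fst) :
    e ∈ (history l t).map Prod.fst := by
  obtain ⟨H, hH⟩ := history_suffix (l := l) h
  rw [hH, List.map_append]
  exact List.mem_append_right _ he

theorem denomProd_cons (h : ℕ × ℕ) (H : List (ℕ × ℕ)) :
    denomProd (h :: H) = h.2 * denomProd H := rfl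

theorem denomProd_history_pos (s : ℕ) : 0 < denomProd (history l s) := by
  induction s with
  | zero => exact one_pos
  | succ s ih =>
    rcases history_succ_cases (l := l) s with h | ⟨e, c, h, hc⟩
    · rwa [h]
    · rw [h, denomProd_cons]
      exact Nat.mul_pos (Nat.pos_of_ne_zero hc.2.1) ih

theorem restraint_le (e s : ℕ) :
    restraint e (history l s) ≤ 2 ^ ((e + 1) * denomProd (history l s)) := by
  induction s with
  | zero => exact le_of_eq (by simp [history, restraint, denomProd])
  | succ s ih =>
    rcases history_succ_cases (l := l) s with h | ⟨e', c, h, hc⟩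
    · rwa [h]
    · rw [h, restraint]
      split_ifs
      · exact le_rfl
      · refine ih.trans (Nat.pow_le_pow_right two_pos (Nat.mul_le_mul_left _ ?_))
        rw [denomProd_cons]
        exact Nat.le_mul_of_pos_left _ (Nat.pos_of_ne_zero hc.2.1)

/-- An action below `e'` sets the restraint of `e'` from the current denominator product, which
bounds every restraint with a smaller index (`restraint_le`). Any other action changes neither side.
-/
theorem restraint_mono {e e' : ℕ} (he : e ≤ e') (s : ℕ) :
    restraint e (history l s) ≤ restraint e' (history l s) := by
  induction s with
  | zero => exact Nat.pow_le_pow_right two_pos (by omega)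
  | succ s ih =>
    have hle := restraint_le (l := l) e (s + 1)
    rcases history_succ_cases (l := l) s with h | ⟨e₁, c, h, hc⟩
    · rwa [h]
    · rw [h] at hle ⊢
      by_cases h1 : e₁ < e'
      · refine hle.trans ?_
        rw [restraint, if_pos h1]
        exact Nat.pow_le_pow_right two_pos (Nat.mul_le_mul_right _ (by omega))
      · rw [restraint, restraint, if_neg h1, if_neg (by omega)]
        exact ih

theorem mem_codeDenom_injurySet {s e c : ℕ}
    (h : history l (s + 1) = (e, codeDenom c) :: history l s) {p : ℕ} (hp : p.Prime)
    (hd : p ∣ codeDenom c) : p ∈ injurySet B l :=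
  Or.inr ⟨hp, s + 1, by rw [h, denomProd_cons]; exact hd.mul_right _⟩

theorem solvableWith_of_canAct {Q : ℕ → Prop} {l : List ℕ} {s : ℕ} {H : List (ℕ × ℕ)} {e c : ℕ}
    (h : CanAct l s H e c) (hQ : ∀ p : ℕ, p.Prime → p ∣ codeDenom c → Q p) :
    SolvableWith Q (Denumerable.ofNat Terms e) := by
  refine solvableWith_iff_exists_list.2 ⟨Denumerable.ofNat (List ℤ) c, ?_, hQ, h.2.2.2.2⟩
  exact Int.natAbs_ne_zero.1 h.2.1

theorem CanAct.allowed {s e c : ℕ} {H : List (ℕ × ℕ)} (hl : ∀ n m, m ∈ l n ↔ m < n ∧ m ∈ B)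
    (h : CanAct (l (s + 1)) s H e c) {p : ℕ} (hp : p.Prime) (hd : p ∣ codeDenom c) :
    Allowed (· ∈ B) H e p := by
  have hle : p ≤ s := (Nat.le_of_dvd (Nat.pos_of_ne_zero h.2.1) hd).trans h.2.2.1
  rcases h.2.2.2.1 p (by omega) with h' | h' | h'
  · exact absurd ⟨hp, hd⟩ h'
  · exact Or.inl ((hl _ _).1 h').2
  · exact Or.inr h'

/-- A satisfied requirement is indeed solvable. -/
theorem solvableWith_of_mem_history {e s : ℕ} (h : e ∈ (history l s).map Prod.fst) :
    SolvableWith (· ∈ injurySet B l) (Denumerable.ofNat Terms e) := by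
  induction s with
  | zero => simp [history] at h
  | succ s ih =>
    rcases history_succ_cases (l := l) s with h' | ⟨e₁, c, h', hc⟩
    · rw [h'] at h; exact ih h
    · rw [h'] at h
      rcases List.mem_cons.1 h with rfl | h
      · exact solvableWith_of_canAct hc fun p hp hd => mem_codeDenom_injurySet h' hp hd
      · exact ih h

/-! ### Stabilisation of the requirements -/

/-- No requirement below `k` acts between the stages `t` and `s`. -/
def QuietUntil (l : ℕ → List ℕ) (k t s : ℕ) : Prop :=
  ∀ e < k, e ∈ (history l s).map Prod.fst → e ∈ (history l t).map Prod.fst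

/-- An action of `e₁ ≥ k` leaves the restraint of `e ≤ k` alone. Any prime it newly inverts exceeds
the restraint of `e₁`, hence that of `e`, and was already allowed for `e`. -/
theorem QuietUntil.preserved (hl : ∀ n m, m ∈ l n ↔ m < n ∧ m ∈ B) {k t s : ℕ} (hts : t ≤ s)
    (h : QuietUntil l k t s) {e : ℕ} (he : e ≤ k) :
    restraint e (history l s) = restraint e (history l t) ∧
      ∀ p : ℕ, p.Prime → Allowed (· ∈ B) (history l s) e p →
        Allowed (· ∈ B) (history l t) e p := by
  induction s, hts using Nat.le_induction with
  | base => exact ⟨rfl, fun _ _ h => h⟩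
  | succ s hts ih =>
    have hq : QuietUntil l k t s := fun e he hes => h e he (history_mono (Nat.le_succ s) hes)
    obtain ⟨ih1, ih2⟩ := ih hq
    rcases history_succ_cases (l := l) s with h' | ⟨e₁, c, h', hc⟩
    · rw [h']; exact ⟨ih1, ih2⟩
    · have he1 : k ≤ e₁ := by
        by_contra! hlt
        exact hc.1 (history_mono hts (h e₁ hlt (by rw [h']; simp)))
      have hr : restraint e (history l (s + 1)) = restraint e (history l s) := by
        rw [h', restraint, if_neg (by simp only; omega)]
      refine ⟨hr.trans ih1, fun p hp hall => ih2 p hp ?_⟩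
      rcases hall with hall | hall | hall
      · exact Or.inl hall
      · rw [h', denomProd_cons] at hall
        rcases hp.dvd_mul.1 hall with hd | hd
        · rcases hc.allowed hl hp hd with h1 | h1 | h1
          · exact Or.inl h1
          · exact Or.inr (Or.inl h1)
          · exact Or.inr (Or.inr ((restraint_mono (he.trans he1) s).trans_lt h1))
        · exact Or.inr (Or.inl hd)
      · exact Or.inr (Or.inr (hr ▸ hall))

/-- A requirement in the history stays there, so each index contributes at most one change. -/
theorem exists_quiet (l : ℕ → List ℕ) (k : ℕ) : ∃ t, ∀ s, QuietUntil l k t s := by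
  induction k with
  | zero => exact ⟨0, fun s e he => absurd he (Nat.not_lt_zero e)⟩
  | succ k ih =>
    obtain ⟨t, ht⟩ := ih
    by_cases h : ∃ s, k ∈ (history l s).map Prod.fst
    · obtain ⟨s, hs⟩ := h
      refine ⟨max t s, fun s' e he hes => ?_⟩
      rcases Nat.lt_succ_iff_lt_or_eq.1 he with he | rfl
      · exact history_mono (le_max_left _ _) (ht s' e he hes)
      · exact history_mono (le_max_right _ _) hs
    · push Not at h
      refine ⟨t, fun s e he hes => ?_⟩
      rcases Nat.lt_succ_iff_lt_or_eq.1 he with he | rfl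
      · exact ht s e he hes
      · exact absurd hes (h s)

/-- At stage `t`, every requirement up to `e` is satisfied or can no longer act. -/
def Settled (B : Set ℕ) (l : ℕ → List ℕ) (e t : ℕ) : Prop :=
  ∀ e' ≤ e, e' ∈ (history l t).map Prod.fst ∨
    ¬ SolvableWith (Allowed (· ∈ B) (history l t) e') (Denumerable.ofNat Terms e')

/-- While the requirements up to `e` are quiet, their allowed primes do not grow; an action by one
of them would solve a polynomial already known to be unsolvable with those primes. -/
theorem Settled.quiet (hl : ∀ n m, m ∈ l n ↔ m < n ∧ m ∈ B) {e t s : ℕ} (h : Settled B l e t)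
    (hts : t ≤ s) : QuietUntil l (e + 1) t s := by
  induction s, hts using Nat.le_induction with
  | base => exact fun _ _ h => h
  | succ s hts ih =>
    intro e' he' hmem
    rcases history_succ_cases (l := l) s with h' | ⟨e₁, c, h', hc⟩
    · rw [h'] at hmem; exact ih e' he' hmem
    · rw [h'] at hmem
      rcases List.mem_cons.1 hmem with rfl | hmem
      · refine (h e' (by simpa using Nat.lt_succ_iff.1 he')).resolve_right fun hns => hns ?_
        exact solvableWith_of_canAct hc fun p hp hd =>
          (ih.preserved hl hts (Nat.le_of_lt he')).2 p hp (hc.allowed hl hp hd)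
      · exact ih e' he' hmem

/-- After the requirements up to `e` are quiet, an unsatisfied but solvable `e' ≤ e` would be able
to act at a late stage. Then some index at most `e'` acts there, contradicting quietness. -/
theorem exists_settled (hl : ∀ n m, m ∈ l n ↔ m < n ∧ m ∈ B) (e : ℕ) :
    ∃ t, Settled B l e t := by
  obtain ⟨t, ht⟩ := exists_quiet l (e + 1)
  refine ⟨t, fun e' he' => or_iff_not_imp_left.2 fun hmem hsol => ?_⟩
  obtain ⟨v, hv0, hv, hev⟩ := solvableWith_iff_exists_list.1 hsol
  obtain ⟨c, hc⟩ : ∃ c, Denumerable.ofNat (List ℤ) c = v :=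
    ⟨Encodable.encode v, Denumerable.ofNat_encode v⟩
  have hcd : codeDenom c = (v.getD 0 0).natAbs := by rw [codeDenom, hc]
  -- Large enough that the search bounded by `s` includes `e'`, the code `c` and its denominator.
  obtain ⟨s, hs⟩ : ∃ s, s = t + c + e' + codeDenom c + 1 := ⟨_, rfl⟩
  have hres := ((ht s).preserved hl (by omega) (show e' ≤ e + 1 by omega)).1
  have hact : CanAct (l (s + 1)) s (history l s) e' c := by
    refine ⟨fun h => hmem (ht s e' (by omega) h), ?_, by omega, fun p hp => ?_,
      by rw [hc]; exact hev⟩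
    · rw [hcd]; exact Int.natAbs_ne_zero.2 hv0
    · refine or_iff_not_imp_left.2 fun hpd => ?_
      obtain ⟨hp1, hpd⟩ := not_not.1 hpd
      rw [hcd] at hpd
      rcases hv p hp1 hpd with h | h | h
      · exact Or.inl ((hl _ _).2 ⟨hp, h⟩)
      · exact Or.inr (Or.inl (h.trans (denomProd_history_dvd (by omega))))
      · exact Or.inr (Or.inr (by rw [hres]; exact h))
  rcases h : (actions (l (s + 1)) s (history l s)).take 1 with _ | ⟨x, L⟩
  · have h0 : actions (l (s + 1)) s (history l s) = [] := by
      simpa using h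
    rw [actions, List.flatMap_eq_nil_iff] at h0
    have h1 := h0 e' (List.mem_range.2 (by omega))
    rw [List.map_eq_nil_iff, List.filter_eq_nil_iff] at h1
    exact h1 c (List.mem_range.2 (by omega)) (by simpa using hact)
  · obtain ⟨c', hc', -, hmin⟩ := mem_actions (x := x) (by rw [h]; simp)
    have hx : x.1 ≤ e' := by
      by_contra! hlt
      exact hmin e' hlt c (by omega) hact
    have hx2 : x.1 ∈ (history l (s + 1)).map Prod.fst := by
      rw [history_succ, h]; simp
    exact hc'.1 (history_mono (by omega) (ht (s + 1) x.1 (by omega) hx2))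

theorem mem_injurySet_allowed (hl : ∀ n m, m ∈ l n ↔ m < n ∧ m ∈ B) {k t e : ℕ}
    (hq : ∀ s ≥ t, QuietUntil l k t s) (he : e ≤ k) {p : ℕ} (hp : p.Prime)
    (h : p ∈ injurySet B l) : Allowed (· ∈ B) (history l t) e p := by
  rcases h with h | ⟨-, s, hs⟩
  · exact Or.inl h
  · refine ((hq (max s t) (le_max_right _ _)).preserved hl (le_max_right _ _) he).2 p hp ?_
    exact Or.inr (Or.inl (hs.trans (denomProd_history_dvd (le_max_left _ _))))

/-- All primes that ever enter the set are already allowed for `e` at stage `t`, so a zero appearing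
later contradicts unsolvability at `t`. -/
theorem Settled.solvableWith_iff (hl : ∀ n m, m ∈ l n ↔ m < n ∧ m ∈ B) {e t : ℕ}
    (h : Settled B l e t) :
    SolvableWith (· ∈ injurySet B l) (Denumerable.ofNat Terms e) ↔
      e ∈ (history l t).map Prod.fst := by
  refine ⟨fun hs => ?_, solvableWith_of_mem_history⟩
  refine (h e le_rfl).resolve_right fun hns => hns (hs.mono fun p hp hpS => ?_)
  exact mem_injurySet_allowed hl (fun s hts => h.quiet hl hts) (Nat.le_succ e) hp hpS

/-! #### Density of the constructed set -/

/-- Bertrand's postulate puts a new prime into each doubling. -/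
theorem le_count_prime_two_pow (m : ℕ) : m ≤ Nat.count Nat.Prime (2 ^ m + 1) := by
  induction m with
  | zero => exact Nat.zero_le _
  | succ m ih =>
    obtain ⟨p, hp, h1, h2⟩ := Nat.exists_prime_lt_and_le_two_mul (2 ^ m) (by positivity)
    have h3 : Nat.count Nat.Prime p < Nat.count Nat.Prime (p + 1) := by
      rw [Nat.count_succ, if_pos hp]; omega
    have h4 : Nat.count Nat.Prime (2 ^ m + 1) ≤ Nat.count Nat.Prime p := Nat.count_monotone _ h1
    have h5 : Nat.count Nat.Prime (p + 1) ≤ Nat.count Nat.Prime (2 ^ (m + 1) + 1) :=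
      Nat.count_monotone _ (by rw [pow_succ]; omega)
    omega

/-- At the least quiet stage, either nothing has happened or the last step was an action below `k`,
which has just reset the restraint of `k` to its maximal value. -/
theorem exists_quiet_restraint (l : ℕ → List ℕ) (k : ℕ) : ∃ t, (∀ s ≥ t, QuietUntil l k t s) ∧
    restraint k (history l t) = 2 ^ ((k + 1) * denomProd (history l t)) := by
  classical
  have hex := exists_quiet l k
  refine ⟨Nat.find hex, fun s _ => Nat.find_spec hex s, ?_⟩
  rcases ht : Nat.find hex with _ | t
  · simp [history, restraint, denomProd]
  · have hspec := Nat.find_spec hex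
    have hmin := Nat.find_min hex (m := t) (by omega)
    rw [ht] at hspec
    rcases history_succ_cases (l := l) t with h | ⟨e, c, h, -⟩
    · refine absurd (fun s => ?_) hmin
      have := hspec s
      rwa [QuietUntil, h] at this
    · have hek : e < k := by
        by_contra! hle
        refine hmin fun s e' he' hes => ?_
        have := hspec s e' he' hes
        rw [h] at this
        rcases List.mem_cons.1 this with h1 | h1
        · simp only at h1; omega
        · exact h1
      rw [h, restraint, if_pos hek]

open Classical in
theorem frequently_count_injurySet_le (hl : ∀ n m, m ∈ l n ↔ m < n ∧ m ∈ B) (k : ℕ) :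
    ∃ N ≥ k, (k + 1) * Nat.count (fun p => p.Prime ∧ p ∈ injurySet B l) (N + 1) ≤
      (k + 1) * Nat.count (· ∈ B) (N + 1) + Nat.count Nat.Prime (N + 1) := by
  obtain ⟨t, hq, hr⟩ := exists_quiet_restraint l k
  set D := denomProd (history l t) with hD
  have hDpos : 0 < D := denomProd_history_pos t
  refine ⟨2 ^ ((k + 1) * D), ?_, ?_⟩
  · have h1 : (k + 1) * D < 2 ^ ((k + 1) * D) := Nat.lt_two_pow_self
    have h2 : k + 1 ≤ (k + 1) * D := Nat.le_mul_of_pos_right _ hDpos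
    omega
  · have h1 := le_count_prime_two_pow ((k + 1) * D)
    have h2 : Nat.count (fun p => p.Prime ∧ p ∈ injurySet B l) (2 ^ ((k + 1) * D) + 1) ≤
        Nat.count (· ∈ B) (2 ^ ((k + 1) * D) + 1) + D := by
      rw [Nat.count_eq_card_filter_range, Nat.count_eq_card_filter_range]
      have hsub : (Finset.range (2 ^ ((k + 1) * D) + 1)).filter
          (fun p => p.Prime ∧ p ∈ injurySet B l) ⊆
          (Finset.range (2 ^ ((k + 1) * D) + 1)).filter (· ∈ B) ∪ Finset.Icc 1 D := by
        intro p hp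
        rw [Finset.mem_filter, Finset.mem_range] at hp
        obtain ⟨hlt, hp1, hpS⟩ := hp
        rw [Finset.mem_union, Finset.mem_filter, Finset.mem_range, Finset.mem_Icc]
        rcases mem_injurySet_allowed hl hq le_rfl hp1 hpS with h | h | h
        · exact Or.inl ⟨hlt, h⟩
        · exact Or.inr ⟨hp1.one_le, Nat.le_of_dvd hDpos h⟩
        · rw [hr] at h; omega
      refine (Finset.card_le_card hsub).trans ((Finset.card_union_le _ _).trans ?_)
      simp
    calc _ ≤ (k + 1) * (Nat.count (· ∈ B) (2 ^ ((k + 1) * D) + 1) + D) :=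
          Nat.mul_le_mul_left _ h2
      _ ≤ _ := by rw [mul_add]; omega

end history

/-! ### The oracle computation -/

open Classical in
/-- The odd primes that the requirement `e` may not invert. -/
noncomputable def forbidden (aux : List (ℕ × ℕ)) (l : List ℕ) (H : List (ℕ × ℕ)) (e : ℕ) :
    List (ℕ × ℕ) :=
  aux.filter fun a => (a.1.Prime ∧ a.1 ≠ 2) ∧ ¬ Allowed (· ∈ l) H e a.1

open Classical in
/-- A polynomial with a rational zero if and only if some requirement up to `e` can still act. -/
noncomputable def unsettledTerms (aux : List (ℕ × ℕ)) (l : List ℕ) (H : List (ℕ × ℕ)) (e : ℕ) :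
    Terms :=
  Terms.prod (((List.range (e + 1)).filter fun e' => e' ∉ H.map Prod.fst).map fun e' =>
    localTerms (Denumerable.ofNat Terms e') (forbidden aux l H e'))

theorem primrec_forbidden {α : Type*} [Primcodable α] {aux : α → List (ℕ × ℕ)} {l : α → List ℕ}
    {H : α → List (ℕ × ℕ)} {e : α → ℕ} (ha : Primrec aux) (hl : Primrec l) (hH : Primrec H)
    (he : Primrec e) : Primrec fun a => forbidden (aux a) (l a) (H a) (e a) := by
  classical
  have hR : PrimrecRel fun (x : ℕ × ℕ) (a : α) =>
      (x.1.Prime ∧ x.1 ≠ 2) ∧ ¬ Allowed (· ∈ l a) (H a) (e a) x.1 := by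
    have hx : Primrec fun y : (ℕ × ℕ) × α => y.1.1 := Primrec.fst.comp .fst
    exact ((primrecPred_prime.comp hx).and (Primrec.eq.comp hx (.const 2)).not).and
      (primrecPred_allowed (hl.comp .snd) (hH.comp .snd) (he.comp .snd) hx).not
  refine ((PrimrecRel.listFilter hR).comp ha .id).of_eq fun a => ?_
  unfold forbidden
  congr!

theorem primrec_unsettledTerms :
    Primrec fun x : (List (ℕ × ℕ) × List ℕ) × (List (ℕ × ℕ) × ℕ) =>
      unsettledTerms x.1.1 x.1.2 x.2.1 x.2.2 := by
  classical
  refine Terms.primrec_prod.comp (Primrec.list_map (primrec_filter_range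
    (R := fun e' (x : (List (ℕ × ℕ) × List ℕ) × (List (ℕ × ℕ) × ℕ)) => e' ∉ x.2.1.map Prod.fst) ?_
    (Primrec.succ.comp (Primrec.snd.comp .snd))) ?_)
  · exact (primrecRel_mem_list.comp .fst (Primrec.list_map
      (Primrec.fst.comp (Primrec.snd.comp .snd)) (Primrec.fst.comp .snd).to₂)).not
  · refine primrec_localTerms.comp (Terms.primrec_ofNat.comp .snd)
      (primrec_forbidden ?_ ?_ ?_ .snd)
    · exact Primrec.fst.comp (Primrec.fst.comp .fst)
    · exact Primrec.snd.comp (Primrec.fst.comp .fst)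
    · exact Primrec.fst.comp (Primrec.snd.comp .fst)

/-- The index of `unsettledTerms`. -/
noncomputable def unsettledIndex (x : (List (ℕ × ℕ) × List ℕ) × (List (ℕ × ℕ) × ℕ)) : ℕ :=
  Encodable.encode (unsettledTerms x.1.1 x.1.2 x.2.1 x.2.2)

theorem primrec_unsettledIndex : Primrec unsettledIndex :=
  Primrec.comp (f := fun L : Terms => Encodable.encode L) Primrec.encode primrec_unsettledTerms

/-- The auxiliary primes of the numbers below `n`. -/
noncomputable def auxList (n : ℕ) : List (ℕ × ℕ) := (List.range n).map fun p => (p, auxPrime p)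

theorem computable_auxList : Computable auxList :=
  computable_list_map_range (Computable.id.pair computable_auxPrime)

section query

variable {l : ℕ → List ℕ} {B : Set ℕ}

/-- The index of a polynomial that has a rational zero if and only if the requirements up to `e`
are not settled at stage `t`. -/
noncomputable def unsettledQuery (l : ℕ → List ℕ) (e t : ℕ) : ℕ :=
  unsettledIndex ((auxList (restraint e (history l t) + 1),
    l (restraint e (history l t) + 1)), (history l t, e))

theorem computable_query_comp {q : (List (ℕ × ℕ) × List ℕ) × (List (ℕ × ℕ) × ℕ) → ℕ}
    (hq : Primrec q) {A h : ℕ → List (ℕ × ℕ)} (hA : Computable A) (hl : Computable l)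
    (hh : Computable h) : Computable₂ fun e t => q ((A (restraint e (h t) + 1),
      l (restraint e (h t) + 1)), (h t, e)) := by
  have hH : Computable fun x : ℕ × ℕ => h x.2 := hh.comp .snd
  have hN : Computable fun x : ℕ × ℕ => restraint x.1 (h x.2) + 1 :=
    Computable.succ.comp (primrec_restraint.to_comp.comp .fst hH)
  exact hq.to_comp.comp (((hA.comp hN).pair (hl.comp hN)).pair (hH.pair .fst))

theorem computable_unsettledQuery (hl : Computable l) : Computable₂ (unsettledQuery l) := by
  exact computable_query_comp (A := auxList) (h := history l) primrec_unsettledIndex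
    computable_auxList hl (computable_history hl)

theorem mem_forbidden_iff {aux : List (ℕ × ℕ)} {l : List ℕ} {H : List (ℕ × ℕ)} {e : ℕ}
    {a : ℕ × ℕ} : a ∈ forbidden aux l H e ↔
      a ∈ aux ∧ (a.1.Prime ∧ a.1 ≠ 2) ∧ ¬ Allowed (· ∈ l) H e a.1 := by
  classical exact List.mem_filter.trans (and_congr_right fun _ => decide_eq_true_iff)

theorem mem_auxList_iff {n : ℕ} {a : ℕ × ℕ} :
    a ∈ auxList n ↔ a.1 < n ∧ a.2 = auxPrime a.1 := by
  simp only [auxList, List.mem_map, List.mem_range]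
  constructor
  · rintro ⟨p, hp, rfl⟩; exact ⟨hp, rfl⟩
  · rintro ⟨h1, h2⟩; exact ⟨a.1, h1, by rw [← h2]⟩

theorem admissible_forbidden (n : ℕ) (l : List ℕ) (H : List (ℕ × ℕ)) (e : ℕ) :
    Admissible auxPrime (forbidden (auxList n) l H e) := by
  refine admissible_of_forall fun a ha => ?_
  obtain ⟨h, ⟨h1, h2⟩, -⟩ := mem_forbidden_iff.1 ha
  exact ⟨h1, h2, (mem_auxList_iff.1 h).2⟩

/-- One table suffices for all `e' ≤ e`: restraints increase with the index, and primes above the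
restraint are allowed. The prime 2, never listed, is allowed because it lies in `B`. -/
theorem notMem_forbidden_iff (hl : ∀ n m, m ∈ l n ↔ m < n ∧ m ∈ B) (h2 : 2 ∈ B) {e e' t p : ℕ}
    (he : e' ≤ e) (hp : p.Prime) :
    p ∉ (forbidden (auxList (restraint e (history l t) + 1)) (l (restraint e (history l t) + 1))
      (history l t) e').map Prod.fst ↔ Allowed (· ∈ B) (history l t) e' p := by
  have hle := restraint_mono (l := l) he t
  rw [List.mem_map]
  constructor
  · intro h
    by_contra hcon
    have hcon' := hcon
    simp only [Allowed, not_or] at hcon'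
    refine h ⟨(p, auxPrime p), mem_forbidden_iff.2 ⟨mem_auxList_iff.2 ⟨by simp only; omega, rfl⟩,
      ⟨hp, ?_⟩, fun hall => hcon ?_⟩, rfl⟩
    · rintro rfl; exact hcon'.1 h2
    · exact hall.imp_left fun h => ((hl _ _).1 h).2
  · rintro h ⟨a, ha, rfl⟩
    obtain ⟨haux, -, hna⟩ := mem_forbidden_iff.1 ha
    exact hna (h.imp_left fun h => (hl _ _).2 ⟨(mem_auxList_iff.1 haux).1, h⟩)

/-- A product has a zero exactly when a factor does, so a single oracle query tests all requirements
up to `e` at once, even though the factors share variables. -/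
theorem unsettledQuery_mem_iff (hl : ∀ n m, m ∈ l n ↔ m < n ∧ m ∈ B) (h2 : 2 ∈ B) (e t : ℕ) :
    unsettledQuery l e t ∈ HTP ℚ ↔ ¬ Settled B l e t := by
  have key : ∀ e' ≤ e, (∃ x : ℕ → ℚ, Terms.eval x (localTerms (Denumerable.ofNat Terms e')
      (forbidden (auxList (restraint e (history l t) + 1)) (l (restraint e (history l t) + 1))
        (history l t) e')) = 0) ↔
      SolvableWith (Allowed (· ∈ B) (history l t) e') (Denumerable.ofNat Terms e') := by
    intro e' he'
    rw [exists_eval_localTerms_iff (admissible_forbidden _ _ _ _)]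
    exact ⟨fun h => h.mono fun p hp => (notMem_forbidden_iff hl h2 he' hp).1,
      fun h => h.mono fun p hp => (notMem_forbidden_iff hl h2 he' hp).2⟩
  unfold unsettledQuery unsettledIndex
  rw [encode_mem_HTP_iff]
  constructor
  · rintro ⟨x, hx⟩ hset
    rw [unsettledTerms, Terms.eval_prod, List.prod_eq_zero_iff] at hx
    obtain ⟨_, hL, hx⟩ := List.mem_map.1 hx
    obtain ⟨e', he', rfl⟩ := List.mem_map.1 hL
    rw [List.mem_filter, List.mem_range, decide_eq_true_iff] at he'
    have hle : e' ≤ e := Nat.lt_succ_iff.1 he'.1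
    exact ((hset e' hle).resolve_left he'.2) ((key e' hle).1 ⟨x, hx⟩)
  · intro hset
    unfold Settled at hset
    push Not at hset
    obtain ⟨e', he', hmem, hs⟩ := hset
    obtain ⟨x, hx⟩ := (key e' he').2 hs
    refine ⟨x, ?_⟩
    rw [unsettledTerms, Terms.eval_prod, List.prod_eq_zero_iff]
    refine List.mem_map.2 ⟨_, List.mem_map.2 ⟨e', ?_, rfl⟩, hx⟩
    rw [List.mem_filter, List.mem_range, decide_eq_true_iff]
    exact ⟨Nat.lt_succ_of_le he', hmem⟩

theorem rePred_injurySet (hc : Computable l) (hl : ∀ n m, m ∈ l n ↔ m < n ∧ m ∈ B) :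
    REPred fun n => n ∈ injurySet B l := by
  classical
  have hP : ComputablePred fun x : ℕ × ℕ =>
      x.1 ∈ l (x.1 + 1) ∨ x.1.Prime ∧ x.1 ∣ denomProd (history l x.2) := by
    have hq : PrimrecPred fun y : ℕ × List ℕ × List (ℕ × ℕ) =>
        y.1 ∈ y.2.1 ∨ y.1.Prime ∧ y.1 ∣ denomProd y.2.2 :=
      (primrecRel_mem_list.comp .fst (Primrec.fst.comp .snd)).or ((primrecPred_prime.comp .fst).and
        (primrecRel_dvd.comp .fst (primrec_denomProd.comp (Primrec.snd.comp .snd))))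
    have h1 : Computable fun x : ℕ × ℕ => (x.1, l (x.1 + 1), history l x.2) :=
      Computable.fst.pair ((hc.comp (Computable.succ.comp .fst)).pair
        ((computable_history hc).comp .snd))
    exact ⟨inferInstance, (hq.decide.to_comp.comp h1).of_eq fun x => rfl⟩
  have h1 : Partrec₂ fun n s : ℕ => (Part.some (decide
      (n ∈ l (n + 1) ∨ n.Prime ∧ n ∣ denomProd (history l s))) : Part Bool) :=
    hP.decide.partrec
  refine ((Partrec.rfind h1).dom_re).of_eq fun n => ?_
  refine Nat.rfind_dom.trans ?_
  simp only [Part.mem_some_iff, Part.some_dom, injurySet, Set.mem_ofPred_eq]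
  constructor
  · rintro ⟨s, hs, -⟩
    have hs : n ∈ l (n + 1) ∨ n.Prime ∧ n ∣ denomProd (history l s) := by simpa using hs
    rcases hs with h | ⟨hp, h⟩
    · exact Or.inl ((hl _ _).1 h).2
    · exact Or.inr ⟨hp, s, h⟩
  · rintro (h | ⟨hp, s, h⟩)
    · exact ⟨0, by simp [hl, h], by simp⟩
    · exact ⟨s, by simp [hp, h], by simp⟩

theorem turingReducible_HTP_injurySet (hc : Computable l)
    (hl : ∀ n m, m ∈ l n ↔ m < n ∧ m ∈ B) (hB : ∀ p ∈ B, p.Prime) (h2 : 2 ∈ B) :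
    TuringReducible (charFun (HTP (invertedRing (injurySet B l)))) (charFun (HTP ℚ)) := by
  classical
  have hprime : ∀ p ∈ injurySet B l, p.Prime := by
    rintro p (h | h)
    · exact hB p h
    · exact h.1
  refine RecursiveIn.iff_nat.2 ?_
  have hquery : Nat.RecursiveIn {charFun (HTP ℚ)} fun n =>
      (Part.some (unsettledQuery l n.unpair.1 n.unpair.2) : Part ℕ) :=
    RecursiveIn.iff_nat.1 ((computable_unsettledQuery hc).comp
      (Computable.fst.comp .unpair) (Computable.snd.comp .unpair)).computableIn
  have horacle := (Nat.RecursiveIn.oracle (charFun (HTP ℚ)) (Set.mem_singleton _)).comp hquery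
  -- Settled stages get the value 0, which is what the unbounded search `rfind` looks for; the
  -- oracle's answer to the query already has this form.
  have hsettled : Nat.RecursiveIn {charFun (HTP ℚ)} fun n =>
      (Part.some (if Settled B l n.unpair.1 n.unpair.2 then 0 else 1) : Part ℕ) := by
    refine horacle.of_eq fun n => (Part.bind_some _ _).trans ?_
    have hq := unsettledQuery_mem_iff hl h2 n.unpair.1 n.unpair.2
    by_cases hs : Settled B l n.unpair.1 n.unpair.2
    · simp only [charFun, if_pos hs, if_neg fun h => hq.1 h hs]
    · simp only [charFun, if_neg hs, if_pos (hq.2 hs)]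
  have hfind : Nat.RecursiveIn {charFun (HTP ℚ)} fun e =>
      (Part.some (Nat.find (exists_settled hl e)) : Part ℕ) := by
    refine hsettled.rfind.of_eq fun e => Part.eq_some_iff.2 (Nat.mem_rfind.2 ⟨?_, fun {m} hm => ?_⟩)
    · simp [Nat.find_spec (exists_settled hl e)]
    · simp [Nat.find_min (exists_settled hl e) hm]
  have hid : Nat.RecursiveIn {charFun (HTP ℚ)} fun n => (Part.some n : Part ℕ) :=
    RecursiveIn.iff_nat.1 Computable.id.computableIn
  have hanswer : Nat.RecursiveIn {charFun (HTP ℚ)} fun n => (Part.some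
      (if n.unpair.1 ∈ (history l n.unpair.2).map Prod.fst then 1 else 0) : Part ℕ) := by
    have hq : Primrec fun y : ℕ × List (ℕ × ℕ) => if y.1 ∈ y.2.map Prod.fst then 1 else 0 :=
      Primrec.ite (primrecRel_mem_list.comp .fst (Primrec.list_map .snd
        (Primrec.fst.comp .snd).to₂)) (.const 1) (.const 0)
    exact RecursiveIn.iff_nat.1 (hq.to_comp.comp ((Computable.fst.comp .unpair).pair
      ((computable_history hc).comp (Computable.snd.comp .unpair)))).computableIn
  refine (hanswer.comp (hid.pair hfind)).of_eq fun e => ?_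
  have hiff : e ∈ HTP (invertedRing (injurySet B l)) ↔
      e ∈ (history l (Nat.find (exists_settled hl e))).map Prod.fst := by
    rw [mem_HTP_invertedRing_iff hprime,
      (Nat.find_spec (exists_settled hl e)).solvableWith_iff hl]
  simp [charFun, hiff, Seq.seq]

end query

theorem mainTheorem1 (r : ℝ) (hr0 : 0 ≤ r) (hr1 : r ≤ 1) (hr : IsComputableReal r) :
    ∃ S : Set ℕ, (∀ p ∈ S, Nat.Prime p) ∧ REPred (fun n : ℕ => n ∈ S) ∧
      lowerPrimeDensity S = r ∧
      SetTuringEquivalent (HTP (invertedRing S)) (HTP ℚ) := by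
  obtain ⟨a, b, ha, hb, hb0, hlim⟩ := hr
  have hl : ∀ n m, m ∈ greedyList a b n ↔ m < n ∧ m ∈ greedySet a b :=
    fun _ _ => mem_greedyList_iff
  have hc := computable_greedyList ha hb
  have hB : ∀ p ∈ greedySet a b, p.Prime := fun _ h => prime_of_mem_greedySet h
  refine ⟨injurySet (greedySet a b) (greedyList a b), ?_, rePred_injurySet hc hl, ?_, ?_, ?_⟩
  · rintro p (h | h)
    · exact hB p h
    · exact h.1
  · exact lowerPrimeDensity_eq (fun _ h => Or.inl h) hB
      (fun ε hε => exists_count_greedySet_le hr0 hb0 hlim hε)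
      (fun ε hε => exists_le_count_greedySet hr1 hb0 hlim hε) (frequently_count_injurySet_le hl)
  · exact turingReducible_HTP_injurySet hc hl hB two_mem_greedySet
  · exact HTP_rat_turingReducible _
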